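/- Let $d\ge 1$ be an integer. For every $m\in\{0,\dots,d-1\}$ and every $(\varepsilon_1,\dots,\varepsilon_m)\in\mathbb N^m$ let $\sum_{i=1}^\infty\delta(P_{\varepsilon_1\dots\varepsilon_m i})$ be a unit intensity Poisson point process on $(0,\infty)$ whose points are arranged in increasing order in $i$ (for $m=0$ this is a single process with points $P_1\le P_2\le\dots$), and assume that all these point processes are independent and defined on a common probability space. The Poisson cascade zeta function is $$\zeta_P(z_1,\dots,z_d)=\sum_{(\varepsilon_1,\dots,\varepsilon_d)\in\mathbb N^d}P_{\varepsilon_1}^{-z_1}P_{\varepsilon_1\varepsilon_2}^{-z_2}\cdots P_{\varepsilon_1\dots\varepsilon_d}^{-z_d}.$$ Put $$\mathcal D=\{z\in\mathbb C^d:\operatorname{Re}z_1>\dots>\operatorname{Re}z_d>1\},\qquad \tfrac12\mathcal D=\{z\in\mathbb C^d:\operatorname{Re}z_1>\dots>\operatorname{Re}z_d>\tfrac12\}.$$ Then, with probability $1$: 1. The series converges absolutely and uniformly on every compact subset of $\mathcal D$, in the sense that both the series and the series of the absolute values of its terms converge uniformly there (along the finite subsets of $\mathbb N^d$); in particular, $\zeta_P$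 is analytic on $\mathcal D$. 2. The function $\zeta_P$, defined originally on $\mathcal D$, admits a meromorphic continuation to $\tfrac12\mathcal D$. Here a function is meromorphic if near every point it is a quotient of two analytic functions whose denominator does not vanish identically. Moreover, denoting the continuation again by $\zeta_P$, the function $(z_d-1)\zeta_P(z_1,\dots,z_d)$ is analytic on $\tfrac12\mathcal D$, where its values at points with $z_d=1$ are understood by continuity. -/

import Mathlib

open MeasureTheory ProbabilityTheory Filter Topology
open scoped ENNReal

namespace PoissonCascade

noncomputable section

/-- A random measure `N` is a Poisson point process with intensity measure `ν` if `N(A)` has the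
Poisson distribution with parameter `ν(A)` for every measurable `A` with `ν(A) < ∞`, and if
`N(A₁), …, N(Aₙ)` are independent for all pairwise disjoint measurable `A₁, …, Aₙ`. -/
structure IsPoissonPointProcess {Ω E : Type*} [MeasurableSpace Ω] [MeasurableSpace E]
    (N : Ω → Measure E) (ν : Measure E) (μ : Measure Ω) : Prop where
  hasLaw : ∀ A : Set E, MeasurableSet A → ν A ≠ ∞ →
    HasLaw (fun ω => N ω A) ((poissonMeasure (ν A).toNNReal).map (Nat.cast : ℕ → ℝ≥0∞)) μ
  indep : ∀ (n : ℕ) (A : Fin n → Set E), (∀ i, MeasurableSet (A i)) →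
    Pairwise (fun i j => Disjoint (A i) (A j)) →
    iIndepFun (fun (i : Fin n) (ω : Ω) => N ω (A i)) μ

/-- The random variables `P 0, P 1, …` are the points, arranged in increasing order, of a unit
intensity Poisson point process `∑ i, δ(P i)` on `(0, ∞)`. (Since the intensity measure gives
mass `0` to `(-∞, 0]`, the points are almost surely positive.) -/
structure IsUnitPoissonPoints {Ω : Type*} [MeasurableSpace Ω]
    (P : ℕ → Ω → ℝ) (μ : Measure Ω) : Prop where
  measurable : ∀ i, Measurable (P i)
  monotone : ∀ᵐ ω ∂μ, Monotone (fun i => P i ω)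
  poisson : IsPoissonPointProcess (fun ω => Measure.sum (fun i => Measure.dirac (P i ω)))
    (volume.restrict (Set.Ioi (0 : ℝ))) μ

/-- The vertices `ε₁ … εₘ`, `0 ≤ m < d`, of the tree to which Poisson processes are attached.
(The indices `εⱼ` and the numbering of the points start at `0` here.) -/
abbrev Prefix (d : ℕ) : Type := Σ m : Fin d, (Fin m → ℕ)

/-- `P ⟨m, (ε₁, …, εₘ)⟩ i` is the point `P_{ε₁ … εₘ i}`. For every `(ε₁, …, εₘ)`, `0 ≤ m < d`,
the points `P_{ε₁ … εₘ i}`, `i ∈ ℕ`, form a unit intensity Poisson point process on `(0, ∞)`, and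
all these processes are independent. -/
structure IsPoissonCascade {Ω : Type*} [MeasurableSpace Ω] (d : ℕ)
    (P : Prefix d → ℕ → Ω → ℝ) (μ : Measure Ω) : Prop where
  points : ∀ v : Prefix d, IsUnitPoissonPoints (P v) μ
  indep : iIndepFun (fun (v : Prefix d) (ω : Ω) => (fun i : ℕ => P v i ω)) μ

/-- For `ε = (ε₁, …, ε_d)`, the `k`-th coordinate `P_{ε₁ … ε_k}` of the cascade point with
label `ε` (here `k : Fin d` is counted from `0`). -/
def coord {Ω : Type*} {d : ℕ} (P : Prefix d → ℕ → Ω → ℝ) (ε : Fin d → ℕ) (k : Fin d) (ω : Ω) :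
    ℝ :=
  P ⟨k, fun j : Fin k => ε (Fin.castLE k.isLt.le j)⟩ (ε k) ω

/-- The term `P_{ε₁}^{-z₁} P_{ε₁ε₂}^{-z₂} ⋯ P_{ε₁…ε_d}^{-z_d}`. -/
def zetaTerm {Ω : Type*} {d : ℕ} (P : Prefix d → ℕ → Ω → ℝ) (ω : Ω) (ε : Fin d → ℕ)
    (z : Fin d → ℂ) : ℂ :=
  ∏ k : Fin d, ((coord P ε k ω : ℝ) : ℂ) ^ (-(z k))

/-- The Poisson cascade zeta function, the sum of the series over all `ε ∈ ℕ^d`. -/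
def zeta {Ω : Type*} {d : ℕ} (P : Prefix d → ℕ → Ω → ℝ) (ω : Ω) (z : Fin d → ℂ) : ℂ :=
  ∑' ε : Fin d → ℕ, zetaTerm P ω ε z

/-- The domain `{Re z₁ > … > Re z_d > c}` in `ℂ^d`. -/
def domain (d : ℕ) (c : ℝ) : Set (Fin d → ℂ) :=
  {z | (∀ i j : Fin d, i < j → (z j).re < (z i).re) ∧ ∀ i : Fin d, c < (z i).re}

/-- `f` is a meromorphic function of several complex variables on `U`: near every point of `U` it
is a quotient `g / h` of analytic functions whose denominator does not vanish identically. The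
values of `f` at the zeros of `h` are irrelevant. -/
def IsMeromorphicOn {d : ℕ} (f : (Fin d → ℂ) → ℂ) (U : Set (Fin d → ℂ)) : Prop :=
  ∀ x ∈ U, ∃ g h : (Fin d → ℂ) → ℂ, AnalyticAt ℂ g x ∧ AnalyticAt ℂ h x ∧
    (¬ ∀ᶠ y in 𝓝 x, h y = 0) ∧ ∀ᶠ y in 𝓝 x, h y ≠ 0 → f y = g y / h y

end

end PoissonCascade

namespace PoissonCascade

noncomputable section

/-! The proof is an induction on the number of levels: the first `m` levels are frozen, and the
independent Poisson processes of the last level are summed. Let `I` be the labels of the first `m`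
levels, `l i` the vector of logarithms of the corresponding coordinates and `q i j` the last-level
points. Fix exponents `a` with a₁ > … > a_m > 1 and attach to `i` the cutoff T_i = exp(-⟨a, l i⟩).
The cutoffs have a finite sum by the convergence result for `m` levels, so almost surely only
finitely many points lie below their cutoff; these contribute an entire function.

Above the cutoff, summation by parts (`tsum_indicator_cexp_eq`) gives T_i^{1-z_d}/(z_d-1) plus an
integral of the compensated count M_i(s), the number of points in (T_i, T_i e^s] minus its mean.
Summed over `i`, the main terms form the m-level series at the shifted exponents z_k + a_k(1 - z_d),
divided by z_d - 1. This is the only source of the pole.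

The M_i are centred, independent, and have variance T_i(e^s - 1). After normalisation by T_i^{-1/2},
the remainder is a random series with coefficients exp(-⟨v, l i⟩), v_k = z_k + a_k(1/2 - z_d).
Cancellation between independent terms is governed by the squares of the coefficients, so 2 Re v
only has to lie in the m-level domain; this is how 1/2 replaces 1. To obtain analyticity in all z at
once, the coefficient is written as ∏ v_k times the integral of exp(-⟨v, τ⟩) over the orthant τ ≥ l
i. The remainder then becomes a Laplace transform in (τ, s) of a random density independent of z
(`prod_mul_tailIntegral`). Its absolute convergence follows from a second moment bound
(`lintegral_absIntegral_ne_top`), and `analyticAt_integral_cexpNeg` applies.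

For fixed `a` this works in a convex region of real parts (`region`). As `a` decreases to (1, …, 1)
these regions cover Re z₁ > … > Re z_d > 1/2 (`exists_mem_region`). They share a point of the domain
of convergence, so the identity theorem glues the continuations. Only countably many almost sure
events are used, for cutoffs `slope m n` and rational exponents; domination by finitely many
rational exponentials covers the rest. -/

/-- The complex exponential `exp (-⟨z, l⟩)`. -/
def cexpNeg {d : ℕ} (z : Fin d → ℂ) (l : Fin d → ℝ) : ℂ := Complex.exp (-∑ k, z k * (l k : ℂ))

/-- The real exponential `exp (-⟨x, l⟩)`. -/
def rexpNeg {d : ℕ} (x : Fin d → ℝ) (l : Fin d → ℝ) : ℝ := Real.exp (-∑ k, x k * l k)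

/-- The vector of real parts. -/
def reVec {d : ℕ} (z : Fin d → ℂ) : Fin d → ℝ := fun k => (z k).re

lemma rexpNeg_pos {d : ℕ} (x l : Fin d → ℝ) : 0 < rexpNeg x l := Real.exp_pos _

lemma norm_cexpNeg {d : ℕ} (z : Fin d → ℂ) (l : Fin d → ℝ) :
    ‖cexpNeg z l‖ = rexpNeg (reVec z) l := by
  simp [cexpNeg, rexpNeg, reVec, Complex.norm_exp]

lemma rexpNeg_eq_prod {d : ℕ} (x l : Fin d → ℝ) :
    rexpNeg x l = ∏ k, Real.exp (-(x k * l k)) := by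
  rw [rexpNeg, ← Finset.sum_neg_distrib, Real.exp_sum]

lemma cexpNeg_eq_prod {d : ℕ} (z : Fin d → ℂ) (l : Fin d → ℝ) :
    cexpNeg z l = ∏ k, Complex.exp (-(z k * l k)) := by
  rw [cexpNeg, ← Finset.sum_neg_distrib, Complex.exp_sum]

@[fun_prop]
lemma continuous_reVec {d : ℕ} : Continuous (reVec (d := d)) := by
  unfold reVec; fun_prop

@[fun_prop]
lemma measurable_rexpNeg {α : Type*} [MeasurableSpace α] {d : ℕ} (x : Fin d → ℝ)
    {l : α → Fin d → ℝ} (hl : Measurable l) : Measurable (fun a => rexpNeg x (l a)) := by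
  unfold rexpNeg; fun_prop

@[fun_prop]
lemma measurable_cexpNeg {α : Type*} [MeasurableSpace α] {d : ℕ} (z : Fin d → ℂ)
    {l : α → Fin d → ℝ} (hl : Measurable l) : Measurable (fun a => cexpNeg z (l a)) := by
  unfold cexpNeg; fun_prop

/-! ### Domination of exponentials by finitely many with rational exponents -/

lemma prod_add_exp_eq_sum_rexpNeg {d : ℕ} (x y l : Fin d → ℝ) :
    ∏ k, (Real.exp (-(x k * l k)) + Real.exp (-(y k * l k))) =
      ∑ s : Fin d → Bool, rexpNeg (fun k => if s k then x k else y k) l := by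
  have : ∀ k, Real.exp (-(x k * l k)) + Real.exp (-(y k * l k)) =
      ∑ b : Bool, Real.exp (-((if b then x k else y k) * l k)) := by
    intro k; simp
  simp_rw [this, rexpNeg_eq_prod]
  rw [Finset.prod_univ_sum, Fintype.piFinset_univ]

/-- The vector with rational coordinates `q`. -/
def ratVec {d : ℕ} (q : Fin d → ℚ) : Fin d → ℝ := fun k => (q k : ℝ)

/-- According to the sign of `l`, the smaller exponent `u` or the larger exponent `v` dominates
alone. -/
lemma exp_mul_exp_abs_le {x l u v r : ℝ} (hu : u ≤ x - r) (hv : x + r ≤ v) :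
    Real.exp (-(x * l)) * Real.exp (r * |l|) ≤ Real.exp (-(u * l)) + Real.exp (-(v * l)) := by
  rw [← Real.exp_add]
  rcases le_total 0 l with h | h
  · rw [abs_of_nonneg h]
    have : Real.exp (-(x * l) + r * l) ≤ Real.exp (-(u * l)) := Real.exp_le_exp.2 (by nlinarith)
    linarith [Real.exp_pos (-(v * l))]
  · rw [abs_of_nonpos h]
    have : Real.exp (-(x * l) + r * -l) ≤ Real.exp (-(v * l)) := Real.exp_le_exp.2 (by nlinarith)
    linarith [Real.exp_pos (-(u * l))]

/-- Near a point of an open set, `exp (-⟨x, l⟩ + r ∑ |l_k|)` is dominated by finitely many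
exponentials with rational exponents in the set. -/
lemma exists_vertices {d : ℕ} {O : Set (Fin d → ℝ)} (hO : IsOpen O) {x : Fin d → ℝ} (hx : x ∈ O) :
    ∃ r > 0, r ≤ 1 / 2 ∧ ∃ V : (Fin d → Bool) → Fin d → ℚ, (∀ s, ratVec (V s) ∈ O) ∧
      ∀ l : Fin d → ℝ, ∏ k, (Real.exp (-((x k - r) * l k)) + Real.exp (-((x k + r) * l k))) ≤
        2 ^ d * ∑ s, rexpNeg (ratVec (V s)) l := by
  obtain ⟨R, hR, hR1, hball⟩ : ∃ R > 0, R ≤ 1 ∧ Metric.ball x R ⊆ O := by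
    obtain ⟨R, hR, hball⟩ := Metric.isOpen_iff.1 hO x hx
    exact ⟨min R 1, lt_min hR one_pos, min_le_right _ _,
      (Metric.ball_subset_ball (min_le_left _ _)).trans hball⟩
  -- Rational exponents within `R` of `x`, hence in the ball, but outside the box of half-width `R /
  -- 2`, so that they dominate every exponent of that box.
  have hlo : ∀ k, ∃ q : ℚ, x k - R < q ∧ (q : ℝ) < x k - R / 2 := fun k =>
    exists_rat_btwn (by linarith)
  have hhi : ∀ k, ∃ q : ℚ, x k + R / 2 < q ∧ (q : ℝ) < x k + R := fun k =>
    exists_rat_btwn (by linarith)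
  choose lo hlo1 hlo2 using hlo
  choose hi hhi1 hhi2 using hhi
  obtain ⟨V, hV⟩ : ∃ V : (Fin d → Bool) → Fin d → ℚ, ∀ s k, V s k = if s k then lo k else hi k :=
    ⟨_, fun _ _ => rfl⟩
  refine ⟨R / 2, by positivity, by linarith, V, fun s => hball ?_, ?_⟩
  · rw [Metric.mem_ball, dist_pi_lt_iff hR]
    intro k
    rw [Real.dist_eq, abs_lt, ratVec, hV]
    split_ifs
    · constructor <;> linarith [hlo1 k, hlo2 k]
    · constructor <;> linarith [hhi1 k, hhi2 k]
  · intro l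
    have h1 : ∀ k, Real.exp (-((x k - R / 2) * l k)) + Real.exp (-((x k + R / 2) * l k)) ≤
        2 * (Real.exp (-((lo k : ℝ) * l k)) + Real.exp (-((hi k : ℝ) * l k))) := by
      intro k
      have key := exp_mul_exp_abs_le (l := l k) (hlo2 k).le (hhi1 k).le
      have hb : ∀ y, |y - x k| ≤ R / 2 → Real.exp (-(y * l k)) ≤
          Real.exp (-(x k * l k)) * Real.exp (R / 2 * |l k|) := by
        intro y hy
        rw [← Real.exp_add]
        refine Real.exp_le_exp.2 ?_
        have : -((y - x k) * l k) ≤ |y - x k| * |l k| := by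
          rw [← abs_mul]; exact neg_le_abs _
        have h3 := mul_le_mul_of_nonneg_right hy (abs_nonneg (l k))
        linarith [sub_mul y (x k) (l k)]
      have e1 := hb (x k - R / 2) (by rw [abs_le]; constructor <;> linarith)
      have e2 := hb (x k + R / 2) (by rw [abs_le]; constructor <;> linarith)
      linarith
    have h2 : ∀ s, rexpNeg (ratVec (V s)) l =
        rexpNeg (fun k => if s k then (lo k : ℝ) else (hi k : ℝ)) l := by
      intro s
      congr 1
      ext k
      rw [ratVec, hV]
      exact apply_ite _ _ _ _
    simp_rw [h2]
    rw [← prod_add_exp_eq_sum_rexpNeg]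
    have h3 := Finset.prod_le_prod (s := Finset.univ) (fun k _ => by positivity)
      (fun k _ => h1 k)
    rw [Finset.prod_mul_distrib, Finset.prod_const, Finset.card_univ, Fintype.card_fin] at h3
    exact h3

/-- Upgrades finiteness at countably many exponents to every exponent of an open set, with a margin
`r`. The margin is kept as a product over coordinates because that form can later be integrated over
orthants coordinate by coordinate. -/
lemma lintegral_prod_add_exp_ne_top {α : Type*} [MeasurableSpace α] {ν : Measure α} {d : ℕ}
    {h : α → ℝ≥0∞} (hh : AEMeasurable h ν) {l : α → Fin d → ℝ} (hl : Measurable l)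
    {O : Set (Fin d → ℝ)} (hO : IsOpen O)
    (hfin : ∀ q : Fin d → ℚ, ratVec q ∈ O →
      ∫⁻ a, h a * ENNReal.ofReal (rexpNeg (ratVec q) (l a)) ∂ν ≠ ∞)
    {x : Fin d → ℝ} (hx : x ∈ O) :
    ∃ r > 0, r ≤ 1 / 2 ∧ ∫⁻ a, h a * ENNReal.ofReal
      (∏ k, (Real.exp (-((x k - r) * l a k)) + Real.exp (-((x k + r) * l a k)))) ∂ν ≠ ∞ := by
  obtain ⟨r, hr, hr1, V, hV, hle⟩ := exists_vertices hO hx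
  refine ⟨r, hr, hr1, ne_top_of_le_ne_top ?_ (lintegral_mono (g := fun a => ENNReal.ofReal (2 ^ d) *
    ∑ s, h a * ENNReal.ofReal (rexpNeg (ratVec (V s)) (l a))) fun a => ?_)⟩
  · rw [lintegral_const_mul'' _ (by
      refine Finset.aemeasurable_fun_sum _ fun s _ => ?_
      exact hh.mul (by fun_prop)),
      lintegral_finsetSum' (f := fun s a => h a * ENNReal.ofReal (rexpNeg (ratVec (V s)) (l a)))
        _ (fun s _ => hh.mul (by fun_prop))]
    exact ENNReal.mul_ne_top ENNReal.ofReal_ne_top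
      (ENNReal.sum_ne_top.2 fun s _ => hfin _ (hV s))
  · dsimp only
    rw [← Finset.mul_sum, ← ENNReal.ofReal_sum_of_nonneg (fun s _ => (rexpNeg_pos _ _).le),
      mul_left_comm, ← ENNReal.ofReal_mul (by positivity)]
    gcongr
    exact hle _

lemma rexpNeg_mul_exp_le {d : ℕ} (x l : Fin d → ℝ) (r : ℝ) :
    rexpNeg x l * Real.exp (r * ∑ k, |l k|) ≤
      ∏ k, (Real.exp (-((x k - r) * l k)) + Real.exp (-((x k + r) * l k))) := by
  rw [rexpNeg_eq_prod, Finset.mul_sum, Real.exp_sum, ← Finset.prod_mul_distrib]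
  exact Finset.prod_le_prod (fun k _ => by positivity)
    fun k _ => exp_mul_exp_abs_le le_rfl le_rfl

/-- The factor exp(r ∑ |l_k|) is the room needed for a power series of radius at least `r` and for a
majorant on a ball. -/
lemma lintegral_rexpNeg_mul_exp_ne_top {α : Type*} [MeasurableSpace α] {ν : Measure α} {d : ℕ}
    {h : α → ℝ≥0∞} (hh : AEMeasurable h ν) {l : α → Fin d → ℝ} (hl : Measurable l)
    {O : Set (Fin d → ℝ)} (hO : IsOpen O)
    (hfin : ∀ q : Fin d → ℚ, ratVec q ∈ O →
      ∫⁻ a, h a * ENNReal.ofReal (rexpNeg (ratVec q) (l a)) ∂ν ≠ ∞)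
    {x : Fin d → ℝ} (hx : x ∈ O) :
    ∃ r > 0, ∫⁻ a, h a * ENNReal.ofReal
      (rexpNeg x (l a) * Real.exp (r * ∑ k, |l a k|)) ∂ν ≠ ∞ := by
  obtain ⟨r, hr, -, h1⟩ := lintegral_prod_add_exp_ne_top hh hl hO hfin hx
  refine ⟨r, hr, ne_top_of_le_ne_top h1 (lintegral_mono fun a => ?_)⟩
  dsimp only
  gcongr
  exact rexpNeg_mul_exp_le _ _ _

lemma lintegral_rexpNeg_ne_top {α : Type*} [MeasurableSpace α] {ν : Measure α} {d : ℕ}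
    {h : α → ℝ≥0∞} (hh : AEMeasurable h ν) {l : α → Fin d → ℝ} (hl : Measurable l)
    {O : Set (Fin d → ℝ)} (hO : IsOpen O)
    (hfin : ∀ q : Fin d → ℚ, ratVec q ∈ O →
      ∫⁻ a, h a * ENNReal.ofReal (rexpNeg (ratVec q) (l a)) ∂ν ≠ ∞)
    {x : Fin d → ℝ} (hx : x ∈ O) :
    ∫⁻ a, h a * ENNReal.ofReal (rexpNeg x (l a)) ∂ν ≠ ∞ := by
  obtain ⟨r, hr, h1⟩ := lintegral_rexpNeg_mul_exp_ne_top hh hl hO hfin hx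
  refine ne_top_of_le_ne_top h1 (lintegral_mono fun a => ?_)
  dsimp only
  gcongr
  exact le_mul_of_one_le_right (rexpNeg_pos _ _).le (Real.one_le_exp (by positivity))

/-! ### Analyticity of multivariate Laplace transforms -/

/-- The linear form `y ↦ -⟨y, l⟩`. -/
def negForm {d : ℕ} (l : Fin d → ℝ) : (Fin d → ℂ) →L[ℂ] ℂ :=
  ∑ k, (-(l k : ℂ)) • (ContinuousLinearMap.proj k : (Fin d → ℂ) →L[ℂ] ℂ)

lemma negForm_apply {d : ℕ} (l : Fin d → ℝ) (y : Fin d → ℂ) :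
    negForm l y = -∑ k, y k * (l k : ℂ) := by
  simp [negForm, mul_comm]

lemma norm_negForm_le {d : ℕ} (l : Fin d → ℝ) : ‖negForm l‖ ≤ ∑ k, |l k| := by
  refine (norm_sum_le _ _).trans (Finset.sum_le_sum fun k _ => ?_)
  rw [norm_smul, norm_neg, Complex.norm_real, Real.norm_eq_abs]
  refine mul_le_of_le_one_right (abs_nonneg _) ?_
  refine ContinuousLinearMap.opNorm_le_bound _ zero_le_one fun y => ?_
  simpa using norm_le_pi_norm y k

/-- The `n`-fold power of a linear form as a multilinear map. -/
def formPow {d : ℕ} (n : ℕ) (φ : (Fin d → ℂ) →L[ℂ] ℂ) :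
    ContinuousMultilinearMap ℂ (fun _ : Fin n => Fin d → ℂ) ℂ :=
  (ContinuousMultilinearMap.mkPiAlgebra ℂ (Fin n) ℂ).compContinuousLinearMap fun _ => φ

lemma norm_formPow_le {d : ℕ} (n : ℕ) (φ : (Fin d → ℂ) →L[ℂ] ℂ) : ‖formPow n φ‖ ≤ ‖φ‖ ^ n := by
  refine (ContinuousMultilinearMap.norm_compContinuousLinearMap_le _ _).trans ?_
  simp

lemma continuous_formPow {d : ℕ} (n : ℕ) : Continuous (formPow (d := d) n) := by
  have h := (ContinuousMultilinearMap.compContinuousLinearMapContinuousMultilinear ℂ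
    (fun _ : Fin n => Fin d → ℂ) (fun _ : Fin n => ℂ) ℂ).cont
  have h2 : Continuous fun φ : (Fin d → ℂ) →L[ℂ] ℂ =>
      (ContinuousMultilinearMap.compContinuousLinearMapContinuousMultilinear ℂ
        (fun _ : Fin n => Fin d → ℂ) (fun _ : Fin n => ℂ) ℂ) (fun _ => φ) :=
    h.comp (continuous_pi fun _ => continuous_id)
  exact h2.clm_apply continuous_const

lemma aestronglyMeasurable_negForm {α : Type*} [MeasurableSpace α] {ν : Measure α} {d : ℕ}
    {l : α → Fin d → ℝ} (hl : Measurable l) :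
    AEStronglyMeasurable (fun a => negForm (l a)) ν := by
  unfold negForm
  refine Finset.aestronglyMeasurable_fun_sum _ fun k _ => ?_
  refine AEStronglyMeasurable.smul_const ?_ _
  exact Measurable.aestronglyMeasurable (by fun_prop)

/-- A multivariate Laplace transform is analytic inside its domain of absolute convergence. -/
theorem analyticAt_integral_cexpNeg {α : Type*} [MeasurableSpace α] {ν : Measure α} {d : ℕ}
    {g : α → ℂ} (hg : AEStronglyMeasurable g ν) {l : α → Fin d → ℝ} (hl : Measurable l)
    {z₀ : Fin d → ℂ} {r : ℝ} (hr : 0 < r)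
    (hfin : ∫⁻ a, ‖g a‖ₑ * ENNReal.ofReal
      (rexpNeg (reVec z₀) (l a) * Real.exp (r * ∑ k, |l a k|)) ∂ν ≠ ∞) :
    AnalyticAt ℂ (fun z => ∫ a, g a * cexpNeg z (l a) ∂ν) z₀ := by
  set w : α → ℝ := fun a => ‖g a‖ * rexpNeg (reVec z₀) (l a) with hw
  set S : α → ℝ := fun a => ∑ k, |l a k| with hS
  have hS0 : ∀ a, 0 ≤ S a := fun a => Finset.sum_nonneg fun k _ => abs_nonneg _
  have hw0 : ∀ a, 0 ≤ w a := fun a => mul_nonneg (norm_nonneg _) (rexpNeg_pos _ _).le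
  have hSm : Measurable S := by
    refine Finset.measurable_fun_sum _ fun k _ => ?_
    exact ((measurable_pi_apply k).comp hl).abs
  have hwm : AEStronglyMeasurable w ν :=
    hg.norm.mul (Measurable.aestronglyMeasurable (by fun_prop))
  have hwint : Integrable (fun a => w a * Real.exp (r * S a)) ν := by
    refine ⟨hwm.mul (Measurable.aestronglyMeasurable (by fun_prop)), ?_⟩
    rw [hasFiniteIntegral_iff_enorm]
    refine lt_of_le_of_lt (lintegral_mono fun a => ?_) (lt_top_iff_ne_top.2 hfin)
    rw [Real.enorm_of_nonneg (mul_nonneg (hw0 a) (Real.exp_pos _).le), hw]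
    dsimp only
    rw [mul_assoc, ENNReal.ofReal_mul (norm_nonneg _), ofReal_norm]
  have hpow : ∀ a (n : ℕ), w a * ((r * S a) ^ n / n.factorial) ≤ w a * Real.exp (r * S a) :=
    fun a n => mul_le_mul_of_nonneg_left
      (Real.pow_div_factorial_le_exp _ (mul_nonneg hr.le (hS0 a)) n) (hw0 a)
  -- Taylor coefficients at `z₀` of the integrand. Since (rS)^n / n! ≤ exp(rS), their integrals
  -- converge and the series has radius at least `r`.
  let q : (n : ℕ) → α → ContinuousMultilinearMap ℂ (fun _ : Fin n => Fin d → ℂ) ℂ := fun n a =>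
    (g a * cexpNeg z₀ (l a) * (n.factorial : ℂ)⁻¹) • formPow n (negForm (l a))
  have hqm : ∀ n, AEStronglyMeasurable (q n) ν := by
    intro n
    have h1 : AEStronglyMeasurable
        (fun a => g a * cexpNeg z₀ (l a) * (n.factorial : ℂ)⁻¹) ν :=
      (hg.mul (Measurable.aestronglyMeasurable (by fun_prop))).mul_const _
    exact h1.smul
      ((continuous_formPow n).comp_aestronglyMeasurable (aestronglyMeasurable_negForm hl))
  have hqn : ∀ n a, ‖q n a‖ * r ^ n ≤ w a * ((r * S a) ^ n / n.factorial) := by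
    intro n a
    have h1 : ‖q n a‖ ≤ w a * (n.factorial : ℝ)⁻¹ * S a ^ n := by
      rw [norm_smul, norm_mul, norm_mul, norm_cexpNeg, norm_inv, Complex.norm_natCast]
      refine mul_le_mul_of_nonneg_left ((norm_formPow_le _ _).trans ?_) ?_
      · exact pow_le_pow_left₀ (norm_nonneg _) (norm_negForm_le _) n
      · have := hw0 a; positivity
    calc ‖q n a‖ * r ^ n ≤ w a * (n.factorial : ℝ)⁻¹ * S a ^ n * r ^ n := by gcongr
      _ = _ := by rw [mul_pow]; ring
  have hqint : ∀ n, Integrable (q n) ν := by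
    intro n
    refine ((hwint.const_mul ((r ^ n)⁻¹))).mono' (hqm n) (ae_of_all _ fun a => ?_)
    rw [← div_eq_inv_mul, le_div_iff₀ (by positivity)]
    exact (hqn n a).trans (hpow a n)
  let p : FormalMultilinearSeries ℂ (Fin d → ℂ) ℂ := fun n => ∫ a, q n a ∂ν
  suffices h : HasFPowerSeriesOnBall (fun z => ∫ a, g a * cexpNeg z (l a) ∂ν) p z₀
      (ENNReal.ofReal r) from h.analyticAt
  refine ⟨?_, ENNReal.ofReal_pos.2 hr, ?_⟩
  · refine p.le_radius_of_bound (∫ a, w a * Real.exp (r * S a) ∂ν) fun n => ?_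
    rw [Real.coe_toNNReal _ hr.le]
    calc ‖p n‖ * r ^ n ≤ (∫ a, ‖q n a‖ ∂ν) * r ^ n := by
          gcongr; exact norm_integral_le_integral_norm _
      _ = ∫ a, ‖q n a‖ * r ^ n ∂ν := (integral_mul_const _ _).symm
      _ ≤ _ := integral_mono ((hqint n).norm.mul_const _) hwint
          fun a => (hqn n a).trans (hpow a n)
  · intro y hy
    have hyr : ‖y‖ ≤ r := by
      rw [Metric.mem_eball, edist_zero_right, ← ofReal_norm,
        ENNReal.ofReal_lt_ofReal_iff hr] at hy
      exact hy.le
    have hpn : ∀ n, p n (fun _ => y) = ∫ a, q n a (fun _ => y) ∂ν := fun n =>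
      ((ContinuousMultilinearMap.apply ℂ (fun _ : Fin n => Fin d → ℂ) ℂ
        (fun _ => y)).integral_comp_comm (hqint n)).symm
    simp_rw [hpn]
    have hqy : ∀ n a, q n a (fun _ => y) =
        g a * cexpNeg z₀ (l a) * ((negForm (l a) y) ^ n / n.factorial) := by
      intro n a
      simp [q, formPow, div_eq_mul_inv]
      ring
    have hexp : ∀ u : ℝ, HasSum (fun n : ℕ => u ^ n / n.factorial) (Real.exp u) := by
      intro u
      rw [Real.exp_eq_exp_ℝ]; exact NormedSpace.expSeries_div_hasSum_exp u
    refine hasSum_integral_of_dominated_convergence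
      (fun n a => w a * ((r * S a) ^ n / n.factorial)) ?_ ?_ ?_ ?_ ?_
    · intro n
      exact (ContinuousMultilinearMap.apply ℂ (fun _ : Fin n => Fin d → ℂ) ℂ
        (fun _ => y)).continuous.comp_aestronglyMeasurable (hqm n)
    · refine fun n => ae_of_all _ fun a => ?_
      refine (ContinuousMultilinearMap.le_opNorm _ _).trans (le_trans ?_ (hqn n a))
      rw [Finset.prod_const, Finset.card_univ, Fintype.card_fin]
      gcongr
    · exact ae_of_all _ fun a => ((hexp _).summable.mul_left _)
    · refine hwint.congr (ae_of_all _ fun a => ?_)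
      dsimp only
      rw [tsum_mul_left, (hexp _).tsum_eq]
    · refine ae_of_all _ fun a => ?_
      simp_rw [hqy]
      have h1 : HasSum (fun n : ℕ => (negForm (l a) y) ^ n / n.factorial)
          (Complex.exp (negForm (l a) y)) := by
        rw [Complex.exp_eq_exp_ℂ]; exact NormedSpace.expSeries_div_hasSum_exp _
      have h2 : g a * cexpNeg (z₀ + y) (l a) =
          g a * cexpNeg z₀ (l a) * Complex.exp (negForm (l a) y) := by
        rw [negForm_apply, cexpNeg, cexpNeg, mul_assoc, ← Complex.exp_add]
        congr 2
        simp only [Pi.add_apply, add_mul, Finset.sum_add_distrib]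
        ring
      rw [h2]
      exact h1.mul_left _

theorem analyticOnNhd_integral_cexpNeg {α : Type*} [MeasurableSpace α] {ν : Measure α} {d : ℕ}
    {g : α → ℂ} (hg : AEStronglyMeasurable g ν) {l : α → Fin d → ℝ} (hl : Measurable l)
    {O : Set (Fin d → ℝ)} (hO : IsOpen O)
    (hfin : ∀ q : Fin d → ℚ, ratVec q ∈ O →
      ∫⁻ a, ‖g a‖ₑ * ENNReal.ofReal (rexpNeg (ratVec q) (l a)) ∂ν ≠ ∞) :
    AnalyticOnNhd ℂ (fun z => ∫ a, g a * cexpNeg z (l a) ∂ν) (reVec ⁻¹' O) := by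
  intro z hz
  obtain ⟨r, hr, h⟩ := lintegral_rexpNeg_mul_exp_ne_top hg.enorm hl hO hfin hz
  exact analyticAt_integral_cexpNeg hg hl hr h

/-! ### Mean and variance of the Poisson distribution -/

lemma hasSum_poisson_mul_id (r : ℝ) :
    HasSum (fun n : ℕ => Real.exp (-r) * r ^ n / n.factorial * n) r := by
  rw [← hasSum_nat_add_iff' 1]
  have h := ((NormedSpace.expSeries_div_hasSum_exp r).mul_left (Real.exp (-r) * r))
  rw [← Real.exp_eq_exp_ℝ, mul_right_comm, ← Real.exp_add] at h
  simp only [neg_add_cancel, Real.exp_zero, one_mul] at h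
  simp only [Finset.range_one, Finset.sum_singleton, CharP.cast_eq_zero, mul_zero, sub_zero]
  refine h.congr_fun fun n => ?_
  rw [Nat.factorial_succ]
  have : (n.factorial : ℝ) ≠ 0 := by positivity
  push_cast
  field_simp
  ring

lemma hasSum_poisson_mul_descFactorial (r : ℝ) :
    HasSum (fun n : ℕ => Real.exp (-r) * r ^ n / n.factorial * (n * (n - 1))) (r ^ 2) := by
  rw [← hasSum_nat_add_iff' 2]
  have h := ((NormedSpace.expSeries_div_hasSum_exp r).mul_left (Real.exp (-r) * r ^ 2))
  rw [← Real.exp_eq_exp_ℝ, mul_right_comm, ← Real.exp_add] at h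
  simp only [neg_add_cancel, Real.exp_zero, one_mul] at h
  simp only [Finset.sum_range_succ, Finset.range_zero, Finset.sum_empty, CharP.cast_eq_zero,
    Nat.cast_one, zero_mul, mul_zero, sub_self, add_zero, sub_zero]
  refine h.congr_fun fun n => ?_
  rw [Nat.factorial_succ, Nat.factorial_succ]
  have : (n.factorial : ℝ) ≠ 0 := by positivity
  push_cast
  field_simp
  ring

/-- Uses (n - r)² = n(n - 1) + (1 - 2r)n + r² and the first two factorial moments. -/
lemma hasSum_poisson_mul_sub_sq (r : ℝ) :
    HasSum (fun n : ℕ => Real.exp (-r) * r ^ n / n.factorial * (n - r) ^ 2) r := by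
  have h0 : HasSum (fun n : ℕ => Real.exp (-r) * r ^ n / n.factorial) 1 := by
    have h := (NormedSpace.expSeries_div_hasSum_exp r).mul_left (Real.exp (-r))
    rw [← Real.exp_eq_exp_ℝ, ← Real.exp_add] at h
    simp only [neg_add_cancel, Real.exp_zero] at h
    exact h.congr_fun fun n => by ring
  have h := ((hasSum_poisson_mul_descFactorial r).add
    ((hasSum_poisson_mul_id r).mul_left (1 - 2 * r))).add (h0.mul_left (r ^ 2))
  have e : r ^ 2 + (1 - 2 * r) * r + r ^ 2 * 1 = r := by ring
  rw [e] at h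
  exact h.congr_fun fun n => by ring

lemma integrable_id_poissonMeasure (r : NNReal) :
    Integrable (fun n : ℕ => (n : ℝ)) (poissonMeasure r) := by
  rw [integrable_poissonMeasure_iff]
  simpa using (hasSum_poisson_mul_id r).summable

lemma integral_id_poissonMeasure (r : NNReal) :
    ∫ n : ℕ, (n : ℝ) ∂(poissonMeasure r) = r := by
  rw [integral_poissonMeasure]
  exact (hasSum_poisson_mul_id r).tsum_eq

lemma integrable_sub_sq_poissonMeasure (r : NNReal) :
    Integrable (fun n : ℕ => ((n : ℝ) - r) ^ 2) (poissonMeasure r) := by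
  rw [integrable_poissonMeasure_iff]
  simpa using (hasSum_poisson_mul_sub_sq r).summable

lemma integral_sub_sq_poissonMeasure (r : NNReal) :
    ∫ n : ℕ, ((n : ℝ) - r) ^ 2 ∂(poissonMeasure r) = r := by
  rw [integral_poissonMeasure]
  exact (hasSum_poisson_mul_sub_sq r).tsum_eq

/-! ### Point counts, Campbell's formula and compensated counts -/

/-- The number of indices `j` with `q j ∈ A`. -/
def pointCount (q : ℕ → ℝ) (A : Set ℝ) : ℝ≥0∞ := ∑' j, A.indicator 1 (q j)

/-- The compensated number of points of `q` in `(t, t * exp s]`. -/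
def compensatedCount (q : ℕ → ℝ) (t s : ℝ) : ℝ :=
  (pointCount q (Set.Ioc t (t * Real.exp s))).toReal - t * (Real.exp s - 1)

section Points

variable {Ω : Type*} [MeasurableSpace Ω] {μ : Measure Ω} {P : ℕ → Ω → ℝ}

lemma IsUnitPoissonPoints.hasLaw_pointCount (h : IsUnitPoissonPoints P μ) {A : Set ℝ}
    (hA : MeasurableSet A) (hfin : volume (A ∩ Set.Ioi 0) ≠ ∞) :
    HasLaw (fun ω => pointCount (fun j => P j ω) A)
      ((poissonMeasure (volume (A ∩ Set.Ioi 0)).toNNReal).map (Nat.cast : ℕ → ℝ≥0∞)) μ := by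
  have h1 := h.poisson.hasLaw A hA (by rwa [Measure.restrict_apply hA])
  rw [Measure.restrict_apply hA] at h1
  convert h1 using 2 with ω
  rw [Measure.sum_apply _ hA, pointCount]
  simp_rw [Measure.dirac_apply' _ hA]

lemma IsUnitPoissonPoints.lintegral_pointCount (h : IsUnitPoissonPoints P μ) {A : Set ℝ}
    (hA : MeasurableSet A) (hfin : volume (A ∩ Set.Ioi 0) ≠ ∞) :
    ∫⁻ ω, pointCount (fun j => P j ω) A ∂μ = volume (A ∩ Set.Ioi 0) := by
  have hl := h.hasLaw_pointCount hA hfin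
  have h1 := hl.lintegral_comp (f := id) (by fun_prop)
  simp only [id] at h1
  rw [h1, lintegral_map (by fun_prop) (by fun_prop)]
  have h2 := integral_id_poissonMeasure (volume (A ∩ Set.Ioi 0)).toNNReal
  have h3 := ofReal_integral_eq_lintegral_ofReal
    (integrable_id_poissonMeasure (volume (A ∩ Set.Ioi 0)).toNNReal)
    (ae_of_all _ fun n => by positivity)
  simp only [ENNReal.ofReal_natCast] at h3
  rw [← h3, h2, ENNReal.ofReal_coe_nnreal, ENNReal.coe_toNNReal hfin]

/-- The left side evaluates a set to the expected number of points in it, which the Poisson law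
identifies when the volume is finite. -/
lemma IsUnitPoissonPoints.sum_map_eq (h : IsUnitPoissonPoints P μ) :
    Measure.sum (fun j => μ.map (P j)) = volume.restrict (Set.Ioi 0) := by
  have key : ∀ A : Set ℝ, MeasurableSet A → volume (A ∩ Set.Ioi 0) ≠ ∞ →
      Measure.sum (fun j => μ.map (P j)) A = volume.restrict (Set.Ioi 0) A := by
    intro A hA hfin
    rw [Measure.restrict_apply hA, ← h.lintegral_pointCount hA hfin, Measure.sum_apply _ hA]
    unfold pointCount
    rw [lintegral_tsum (f := fun j ω => A.indicator 1 (P j ω)) fun j =>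
      ((measurable_one.indicator hA).comp (h.measurable j)).aemeasurable]
    refine tsum_congr fun j => ?_
    rw [← lintegral_map (f := A.indicator 1) (measurable_one.indicator hA) (h.measurable j),
      lintegral_indicator_one hA]
  ext A hA
  -- Exhaustion by bounded sets, since the Poisson law gives the expected count only for sets of
  -- finite volume.
  have hmono : Monotone fun n : ℕ => A ∩ Set.Icc (-(n : ℝ)) n := by
    intro n k hnk
    have : (n : ℝ) ≤ k := by exact_mod_cast hnk
    exact Set.inter_subset_inter_right _ (Set.Icc_subset_Icc (by linarith) this)
  have hU : A = ⋃ n : ℕ, A ∩ Set.Icc (-(n : ℝ)) n := by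
    rw [← Set.inter_iUnion]
    refine (Set.inter_eq_left.2 fun x _ => ?_).symm
    obtain ⟨n, hn⟩ := exists_nat_ge |x|
    exact Set.mem_iUnion.2 ⟨n, abs_le.1 hn⟩
  rw [hU, hmono.measure_iUnion, hmono.measure_iUnion]
  refine iSup_congr fun n => key _ (hA.inter measurableSet_Icc) ?_
  refine ne_top_of_le_ne_top ?_ (measure_mono (t := Set.Icc (-(n : ℝ)) n) fun x hx => hx.1.2)
  rw [Real.volume_Icc]
  exact ENNReal.ofReal_ne_top

/-- Campbell's formula. -/
lemma IsUnitPoissonPoints.tsum_lintegral (h : IsUnitPoissonPoints P μ) {f : ℝ → ℝ≥0∞}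
    (hf : Measurable f) :
    ∑' j, ∫⁻ ω, f (P j ω) ∂μ = ∫⁻ t in Set.Ioi 0, f t := by
  rw [← h.sum_map_eq, lintegral_sum_measure]
  exact tsum_congr fun j => (lintegral_map hf (h.measurable j)).symm

/-- The expected number of points in (-∞, 0] is zero. -/
lemma IsUnitPoissonPoints.ae_pos (h : IsUnitPoissonPoints P μ) : ∀ᵐ ω ∂μ, ∀ j, 0 < P j ω := by
  rw [ae_all_iff]
  intro j
  have h1 : Measure.sum (fun j => μ.map (P j)) (Set.Iic 0) = 0 := by
    rw [h.sum_map_eq, Measure.restrict_apply measurableSet_Iic,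
      Set.Iic_inter_Ioi, Set.Ioc_self, measure_empty]
  have h2 : μ.map (P j) (Set.Iic 0) = 0 := by
    refine le_antisymm (h1 ▸ ?_) zero_le
    exact Measure.le_sum (fun j => μ.map (P j)) j _
  rw [Measure.map_apply (h.measurable j) measurableSet_Iic] at h2
  rw [ae_iff]
  simpa [Set.preimage, not_lt] using h2

lemma volume_Ioc_inter_Ioi {t s : ℝ} (ht : 0 ≤ t) :
    volume (Set.Ioc t (t * Real.exp s) ∩ Set.Ioi 0) = ENNReal.ofReal (t * (Real.exp s - 1)) := by
  have : Set.Ioc t (t * Real.exp s) ∩ Set.Ioi 0 = Set.Ioc t (t * Real.exp s) :=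
    Set.inter_eq_left.2 fun x hx => lt_of_le_of_lt ht hx.1
  rw [this, Real.volume_Ioc]
  congr 1
  ring

lemma IsUnitPoissonPoints.hasLaw_Ioc (hP : IsUnitPoissonPoints P μ) {t s : ℝ}
    (ht : 0 ≤ t) :
    HasLaw (fun ω => pointCount (fun j => P j ω) (Set.Ioc t (t * Real.exp s)))
      ((poissonMeasure (t * (Real.exp s - 1)).toNNReal).map (Nat.cast : ℕ → ℝ≥0∞)) μ := by
  have h := hP.hasLaw_pointCount (A := Set.Ioc t (t * Real.exp s)) measurableSet_Ioc
    (by rw [volume_Ioc_inter_Ioi ht]; exact ENNReal.ofReal_ne_top)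
  rwa [volume_Ioc_inter_Ioi ht] at h

lemma IsUnitPoissonPoints.integral_comp_compensatedCount (hP : IsUnitPoissonPoints P μ) {t s : ℝ}
    (ht : 0 ≤ t) (hs : 0 ≤ s) {f : ℝ → ℝ} (hf : Measurable f) :
    ∫ ω, f (compensatedCount (fun j => P j ω) t s) ∂μ =
      ∫ n : ℕ, f (n - (t * (Real.exp s - 1)).toNNReal)
        ∂(poissonMeasure (t * (Real.exp s - 1)).toNNReal) := by
  have h0 : 0 ≤ t * (Real.exp s - 1) := mul_nonneg ht (by linarith [Real.one_le_exp hs])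
  have h := (hP.hasLaw_Ioc (s := s) ht).integral_comp
    (f := fun x : ℝ≥0∞ => f (x.toReal - t * (Real.exp s - 1)))
    (Measurable.aestronglyMeasurable (by fun_prop))
  rw [integral_map (by fun_prop) (Measurable.aestronglyMeasurable (by fun_prop))] at h
  simp only [Real.coe_toNNReal _ h0]
  simpa [Function.comp_def, compensatedCount] using h

lemma IsUnitPoissonPoints.integrable_comp_compensatedCount (hP : IsUnitPoissonPoints P μ)
    {t s : ℝ} (ht : 0 ≤ t) (hs : 0 ≤ s) {f : ℝ → ℝ} (hf : Measurable f)
    (hint : Integrable (fun n : ℕ => f (n - (t * (Real.exp s - 1)).toNNReal))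
        (poissonMeasure (t * (Real.exp s - 1)).toNNReal)) :
    Integrable (fun ω => f (compensatedCount (fun j => P j ω) t s)) μ := by
  have h0 : 0 ≤ t * (Real.exp s - 1) := mul_nonneg ht (by linarith [Real.one_le_exp hs])
  have hl := hP.hasLaw_Ioc (s := s) ht
  simp only [Real.coe_toNNReal _ h0] at hint
  have h1 : Integrable (fun x : ℝ≥0∞ => f (x.toReal - t * (Real.exp s - 1)))
      ((poissonMeasure (t * (Real.exp s - 1)).toNNReal).map (Nat.cast : ℕ → ℝ≥0∞)) := by
    rw [integrable_map_measure (Measurable.aestronglyMeasurable (by fun_prop)) (by fun_prop)]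
    simpa [Function.comp_def] using hint
  rw [← hl.map_eq] at h1
  exact h1.comp_aemeasurable hl.aemeasurable

lemma IsUnitPoissonPoints.integral_compensatedCount [IsProbabilityMeasure μ]
    (hP : IsUnitPoissonPoints P μ) {t s : ℝ} (ht : 0 ≤ t) (hs : 0 ≤ s) :
    ∫ ω, compensatedCount (fun j => P j ω) t s ∂μ = 0 := by
  rw [hP.integral_comp_compensatedCount ht hs (f := fun x => x) measurable_id,
    integral_sub (integrable_id_poissonMeasure _) (integrable_const _),
    integral_id_poissonMeasure]
  simp

lemma IsUnitPoissonPoints.integral_compensatedCount_sq (hP : IsUnitPoissonPoints P μ) {t s : ℝ}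
    (ht : 0 ≤ t) (hs : 0 ≤ s) :
    ∫ ω, compensatedCount (fun j => P j ω) t s ^ 2 ∂μ = t * (Real.exp s - 1) := by
  rw [hP.integral_comp_compensatedCount ht hs (f := fun x => x ^ 2) (by fun_prop),
    integral_sub_sq_poissonMeasure, Real.coe_toNNReal]
  exact mul_nonneg ht (by linarith [Real.one_le_exp hs])

@[fun_prop]
lemma measurable_pointCount_Ioc {α : Type*} [MeasurableSpace α] {q : α → ℕ → ℝ}
    (hq : Measurable q) {u v : α → ℝ} (hu : Measurable u) (hv : Measurable v) :
    Measurable fun a => pointCount (q a) (Set.Ioc (u a) (v a)) := by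
  unfold pointCount
  refine Measurable.tsum fun j => ?_
  have hqj : Measurable fun a => q a j := (measurable_pi_apply j).comp hq
  have : (fun a => (Set.Ioc (u a) (v a)).indicator (1 : ℝ → ℝ≥0∞) (q a j)) =
      ({a | u a < q a j} ∩ {a | q a j ≤ v a}).indicator 1 := by
    ext a
    simp [Set.indicator_apply]
  rw [this]
  exact measurable_one.indicator
    ((measurableSet_lt hu hqj).inter (measurableSet_le hqj hv))

@[fun_prop]
lemma measurable_compensatedCount {α : Type*} [MeasurableSpace α] {q : α → ℕ → ℝ}
    (hq : Measurable q) {u v : α → ℝ} (hu : Measurable u) (hv : Measurable v) :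
    Measurable fun a => compensatedCount (q a) (u a) (v a) := by
  unfold compensatedCount
  fun_prop

lemma IsUnitPoissonPoints.memLp_compensatedCount (hP : IsUnitPoissonPoints P μ) {t s : ℝ}
    (ht : 0 ≤ t) (hs : 0 ≤ s) : MemLp (fun ω => compensatedCount (fun j => P j ω) t s) 2 μ := by
  have hm : Measurable fun ω => compensatedCount (fun j => P j ω) t s :=
    measurable_compensatedCount (measurable_pi_lambda _ hP.measurable) measurable_const
      measurable_const
  rw [memLp_two_iff_integrable_sq hm.aestronglyMeasurable]
  exact hP.integrable_comp_compensatedCount ht hs (f := fun x => x ^ 2) (by fun_prop)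
    (integrable_sub_sq_poissonMeasure _)

end Points

/-- Second moment of a finite linear combination of independent compensated counts. -/
lemma integral_sum_compensatedCount_sq {Ω I : Type*} [MeasurableSpace Ω] {μ : Measure Ω}
    [IsProbabilityMeasure μ] {Q : I → ℕ → Ω → ℝ} (hQ : ∀ i, IsUnitPoissonPoints (Q i) μ)
    (hind : iIndepFun (fun i ω j => Q i j ω) μ) (S : Finset I) (c t : I → ℝ)
    (ht : ∀ i, 0 ≤ t i) {s : ℝ} (hs : 0 ≤ s) :
    ∫⁻ ω, ENNReal.ofReal ((∑ i ∈ S, c i * compensatedCount (fun j => Q i j ω) (t i) s) ^ 2) ∂μ =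
      ENNReal.ofReal (∑ i ∈ S, c i ^ 2 * (t i * (Real.exp s - 1))) := by
  set X : I → Ω → ℝ := fun i ω => c i * compensatedCount (fun j => Q i j ω) (t i) s with hX
  have hmem : ∀ i, MemLp (X i) 2 μ := fun i =>
    ((hQ i).memLp_compensatedCount (ht i) hs).const_mul (c i)
  have hpair : Set.Pairwise (S : Set I) fun i k => IndepFun (X i) (X k) μ := by
    intro i _ k _ hik
    have hm : ∀ i, Measurable fun q : ℕ → ℝ => c i * compensatedCount q (t i) s := fun i => by
      fun_prop
    exact (hind.indepFun hik).comp (hm i) (hm k)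
  have hmean : ∀ i, ∫ ω, X i ω ∂μ = 0 := by
    intro i
    rw [hX, integral_const_mul, (hQ i).integral_compensatedCount (ht i) hs, mul_zero]
  -- The summands are centred and pairwise independent, so the cross terms vanish and second moments
  -- add.
  have hv := IndepFun.variance_sum (s := S) (fun i _ => hmem i) hpair
  have hmemS : MemLp (∑ i ∈ S, X i) 2 μ := memLp_finsetSum' _ fun i _ => hmem i
  have hmeanS : ∫ ω, (∑ i ∈ S, X i) ω ∂μ = 0 := by
    simp only [Finset.sum_apply]
    rw [integral_finsetSum _ fun i _ => (hmem i).integrable one_le_two]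
    simp [hmean]
  rw [variance_of_integral_eq_zero hmemS.aestronglyMeasurable.aemeasurable hmeanS] at hv
  have hvi : ∀ i, variance (X i) μ = c i ^ 2 * (t i * (Real.exp s - 1)) := by
    intro i
    rw [variance_of_integral_eq_zero (hmem i).aestronglyMeasurable.aemeasurable (hmean i)]
    simp only [hX, mul_pow]
    rw [integral_const_mul, (hQ i).integral_compensatedCount_sq (ht i) hs]
  simp_rw [hvi] at hv
  rw [← hv, ofReal_integral_eq_lintegral_ofReal]
  · simp only [Finset.sum_apply, hX]
  · exact hmemS.integrable_sq
  · exact ae_of_all _ fun ω => sq_nonneg _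

/-! ### Domains of exponents, and Fubini's theorem for independent variables -/

/-- The set `{x₁ > … > x_d > c}` in `ℝ^d`. -/
def realDomain (d : ℕ) (c : ℝ) : Set (Fin d → ℝ) :=
  {x | (∀ i j : Fin d, i < j → x j < x i) ∧ ∀ i : Fin d, c < x i}

lemma isOpen_realDomain (d : ℕ) (c : ℝ) : IsOpen (realDomain d c) := by
  simp only [realDomain, Set.ofPred_and, Set.ofPred_forall]
  refine IsOpen.inter ?_ ?_
  · refine isOpen_iInter_of_finite fun i => isOpen_iInter_of_finite fun j =>
      isOpen_iInter_of_finite fun _ => isOpen_lt (by fun_prop) (by fun_prop)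
  · exact isOpen_iInter_of_finite fun i => isOpen_lt (by fun_prop) (by fun_prop)

lemma convex_realDomain (d : ℕ) (c : ℝ) : Convex ℝ (realDomain d c) := by
  intro x hx y hy a b ha hb hab
  have key : ∀ {u v u' v' : ℝ}, u < v → u' < v' → a * u + b * u' < a * v + b * v' := by
    intro u v u' v' h h'
    rcases ha.eq_or_lt with rfl | ha'
    · have : b = 1 := by linarith
      subst this; linarith
    · nlinarith [mul_le_mul_of_nonneg_left h'.le hb, mul_lt_mul_of_pos_left h ha']
  refine ⟨fun i j hij => ?_, fun i => ?_⟩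
  · simpa using key (hx.1 i j hij) (hy.1 i j hij)
  · have := key (hx.2 i) (hy.2 i)
    rw [← add_mul, hab, one_mul] at this
    simpa using this

/-- The exponents `z_k + a_k (c - z_d)`, `k < d`. -/
def affExp {R : Type*} [Ring R] {m : ℕ} (c : R) (a : Fin m → R) (z : Fin (m + 1) → R) :
    Fin m → R :=
  fun k => z k.castSucc + a k * (c - z (Fin.last m))

lemma reVec_affExp {m : ℕ} (c : ℝ) (a : Fin m → ℝ) (z : Fin (m + 1) → ℂ) :
    reVec (affExp (c : ℂ) (fun k => (a k : ℂ)) z) = affExp c a (reVec z) := by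
  ext k
  simp [reVec, affExp]

/-- The array has finite exponential sums `∑ i, exp (-⟨x, l i⟩)` for `x₁ > … > x_m > 1`. -/
def FiniteExpSums {I : Type*} {m : ℕ} (l : I → Fin m → ℝ) : Prop :=
  ∀ x ∈ realDomain m 1, ∑' i, ENNReal.ofReal (rexpNeg x (l i)) ≠ ∞

/-- A measurable function of two independent random variables is almost surely finite if its
partial expectations are. -/
lemma ae_ne_top_of_indepFun {Ω α β : Type*} [MeasurableSpace Ω] [MeasurableSpace α]
    [MeasurableSpace β] {μ : Measure Ω} [IsProbabilityMeasure μ] {X : Ω → α} {Y : Ω → β}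
    (hX : Measurable X) (hY : Measurable Y) (hind : IndepFun X Y μ) {f : α → β → ℝ≥0∞}
    (hf : Measurable (Function.uncurry f)) (h : ∀ᵐ ω ∂μ, ∫⁻ ω', f (X ω) (Y ω') ∂μ ≠ ∞) :
    ∀ᵐ ω ∂μ, f (X ω) (Y ω) ≠ ∞ := by
  have hs : MeasurableSet {p : α × β | f p.1 p.2 ≠ ∞} :=
    (measurableSet_eq_fun hf measurable_const).compl
  have : ∀ᵐ p ∂(μ.map fun ω => (X ω, Y ω)), f p.1 p.2 ≠ ∞ := by
    rw [(indepFun_iff_map_prod_eq_prod_map_map hX.aemeasurable hY.aemeasurable).1 hind]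
    -- The joint law is now a product law, so the first variable can be frozen and finiteness of the
    -- partial expectation used.
    refine (Measure.ae_prod_mem_iff_ae_ae_mem hs).2 ?_
    have hs2 : MeasurableSet {x : α | ∀ᵐ y ∂(μ.map Y), (x, y) ∈ {p : α × β | f p.1 p.2 ≠ ∞}} := by
      have : {x : α | ∀ᵐ y ∂(μ.map Y), (x, y) ∈ {p : α × β | f p.1 p.2 ≠ ∞}} =
          {x | μ.map Y (Prod.mk x ⁻¹' {p : α × β | f p.1 p.2 ≠ ∞}ᶜ) = 0} := rfl
      rw [this]
      exact measurableSet_eq_fun (measurable_measure_prodMk_left hs.compl) measurable_const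
    refine (ae_map_iff hX.aemeasurable hs2).2 ?_
    filter_upwards [h] with ω hω
    have hfω : Measurable (f (X ω)) := hf.comp measurable_prodMk_left
    refine (ae_map_iff hY.aemeasurable (hs.preimage measurable_prodMk_left)).2 ?_
    filter_upwards [ae_lt_top (hfω.comp hY) hω] with ω' hω'
    exact hω'.ne
  exact (ae_map_iff (hX.prodMk hY).aemeasurable hs).1 this

lemma lintegral_exp_neg_mul_log {x t : ℝ} (hx : 1 < x) (ht : 0 < t) :
    ∫⁻ s in Set.Ioi t, ENNReal.ofReal (Real.exp (-(x * Real.log s))) =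
      ENNReal.ofReal (Real.exp ((1 - x) * Real.log t) / (x - 1)) := by
  have h1 : ∀ s ∈ Set.Ioi t, ENNReal.ofReal (Real.exp (-(x * Real.log s))) =
      ENNReal.ofReal (s ^ (-x)) := by
    intro s hs
    rw [Real.rpow_def_of_pos (ht.trans hs)]
    congr 2; ring
  rw [setLIntegral_congr_fun measurableSet_Ioi h1, ← ofReal_integral_eq_lintegral_ofReal
    (integrableOn_Ioi_rpow_of_lt (by linarith) ht), integral_Ioi_rpow_of_lt (by linarith) ht,
    Real.rpow_def_of_pos ht]
  · congr 1
    rw [show -x + 1 = -(x - 1) by ring, neg_div_neg_eq]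
    congr 2
    ring
  · refine (ae_restrict_mem measurableSet_Ioi).mono fun s hs => ?_
    exact Real.rpow_nonneg (ht.trans hs).le _

/-! ### Expected contributions below and above the cutoffs -/

section Conditions

variable {I : Type*} {m : ℕ}

/-- The number of pairs `(i, j)` such that `q i j` is below the cutoff `exp (-⟨a, l i⟩)`. -/
def lowCount (a : Fin m → ℝ) (l : I → Fin m → ℝ) (q : I → ℕ → ℝ) : ℝ≥0∞ :=
  ∑' i, pointCount (q i) (Set.Ioc 0 (rexpNeg a (l i)))

/-- The sum of `exp (-⟨x', l i⟩) (q i j) ^ (-x_d)` over the points above the cutoff. -/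
def highSum (a : Fin m → ℝ) (x : Fin (m + 1) → ℝ) (l : I → Fin m → ℝ) (q : I → ℕ → ℝ) : ℝ≥0∞ :=
  ∑' i, ∑' j, ENNReal.ofReal (rexpNeg (fun k => x k.castSucc) (l i)) *
    (Set.Ioi (rexpNeg a (l i))).indicator
      (fun t => ENNReal.ofReal (Real.exp (-(x (Fin.last m) * Real.log t)))) (q i j)

variable [Countable I]

lemma measurable_lowCount (a : Fin m → ℝ) :
    Measurable (Function.uncurry (lowCount (I := I) a)) := by
  unfold lowCount Function.uncurry
  refine Measurable.tsum fun i => ?_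
  have h1 : Measurable fun p : (I → Fin m → ℝ) × (I → ℕ → ℝ) => p.1 i :=
    (measurable_pi_apply i).comp measurable_fst
  have h2 : Measurable fun p : (I → Fin m → ℝ) × (I → ℕ → ℝ) => p.2 i :=
    (measurable_pi_apply i).comp measurable_snd
  exact measurable_pointCount_Ioc h2 measurable_const (measurable_rexpNeg a h1)

lemma measurable_highSum (a : Fin m → ℝ) (x : Fin (m + 1) → ℝ) :
    Measurable (Function.uncurry (highSum (I := I) a x)) := by
  unfold highSum Function.uncurry
  refine Measurable.tsum fun i => Measurable.tsum fun j => ?_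
  have h1 : Measurable fun p : (I → Fin m → ℝ) × (I → ℕ → ℝ) => p.1 i :=
    (measurable_pi_apply i).comp measurable_fst
  have h2 : Measurable fun p : (I → Fin m → ℝ) × (I → ℕ → ℝ) => p.2 i j :=
    (measurable_pi_apply j).comp ((measurable_pi_apply i).comp measurable_snd)
  refine (measurable_rexpNeg _ h1).ennreal_ofReal.mul ?_
  have : (fun p : (I → Fin m → ℝ) × (I → ℕ → ℝ) => (Set.Ioi (rexpNeg a (p.1 i))).indicator
      (fun t => ENNReal.ofReal (Real.exp (-(x (Fin.last m) * Real.log t)))) (p.2 i j)) =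
      {p | rexpNeg a (p.1 i) < p.2 i j}.indicator
        fun p => ENNReal.ofReal (Real.exp (-(x (Fin.last m) * Real.log (p.2 i j)))) := by
    ext p
    simp [Set.indicator_apply]
  rw [this]
  exact Measurable.indicator (by fun_prop) (measurableSet_lt (measurable_rexpNeg a h1) h2)

variable {Ω : Type*} [MeasurableSpace Ω] {μ : Measure Ω} {Q : I → ℕ → Ω → ℝ}

/-- The expected number of points in (0, T_i] is T_i, and the cutoffs are summable because `a` lies
in the domain of convergence of the previous level. -/
lemma lintegral_lowCount_ne_top (hQ : ∀ i, IsUnitPoissonPoints (Q i) μ) {a : Fin m → ℝ}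
    (ha : a ∈ realDomain m 1) {l : I → Fin m → ℝ} (hl : FiniteExpSums l) :
    ∫⁻ ω, lowCount a l (fun i j => Q i j ω) ∂μ ≠ ∞ := by
  unfold lowCount
  rw [lintegral_tsum fun i => (measurable_pointCount_Ioc (measurable_pi_lambda _ (hQ i).measurable)
    measurable_const measurable_const).aemeasurable]
  convert hl a ha using 3 with i
  have h0 : Set.Ioc 0 (rexpNeg a (l i)) ∩ Set.Ioi 0 = Set.Ioc 0 (rexpNeg a (l i)) :=
    Set.inter_eq_left.2 fun x hx => hx.1
  have h1 : volume (Set.Ioc 0 (rexpNeg a (l i)) ∩ Set.Ioi 0) =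
      ENNReal.ofReal (rexpNeg a (l i)) := by
    rw [h0, Real.volume_Ioc, sub_zero]
  rw [(hQ i).lintegral_pointCount measurableSet_Ioc (by rw [h1]; exact ENNReal.ofReal_ne_top), h1]

lemma rexpNeg_mul_exp_affExp (a : Fin m → ℝ) (c : ℝ) (x : Fin (m + 1) → ℝ) (l : Fin m → ℝ) :
    rexpNeg (fun k => x k.castSucc) l *
      Real.exp ((c - x (Fin.last m)) * Real.log (rexpNeg a l)) = rexpNeg (affExp c a x) l := by
  rw [rexpNeg, rexpNeg, rexpNeg, Real.log_exp, ← Real.exp_add]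
  congr 1
  simp only [affExp, add_mul, Finset.sum_add_distrib, mul_neg, Finset.mul_sum, neg_add]
  congr 2
  exact Finset.sum_congr rfl fun k _ => by ring

/-- By Campbell's formula the inner sum has expectation T_i^{1-x_d}/(x_d - 1). Multiplication by the
previous coordinates turns the outer sum into the m-level sum at `affExp 1 a x`. -/
lemma lintegral_highSum_ne_top (hQ : ∀ i, IsUnitPoissonPoints (Q i) μ) {a : Fin m → ℝ}
    {x : Fin (m + 1) → ℝ} (hx1 : 1 < x (Fin.last m)) (hx : affExp 1 a x ∈ realDomain m 1)
    {l : I → Fin m → ℝ} (hl : FiniteExpSums l) :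
    ∫⁻ ω, highSum a x l (fun i j => Q i j ω) ∂μ ≠ ∞ := by
  unfold highSum
  set f : I → ℝ → ℝ≥0∞ := fun i => (Set.Ioi (rexpNeg a (l i))).indicator
      (fun t => ENNReal.ofReal (Real.exp (-(x (Fin.last m) * Real.log t)))) with hf
  have hfm : ∀ i, Measurable (f i) := fun i =>
    Measurable.indicator (by fun_prop) measurableSet_Ioi
  have hfQ : ∀ i j, Measurable fun ω => f i (Q i j ω) := fun i j =>
    (hfm i).comp ((hQ i).measurable j)
  have hint : ∀ i, ∫⁻ t in Set.Ioi 0, f i t = ENNReal.ofReal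
      (Real.exp ((1 - x (Fin.last m)) * Real.log (rexpNeg a (l i))) / (x (Fin.last m) - 1)) := by
    intro i
    rw [hf, lintegral_indicator measurableSet_Ioi, Measure.restrict_restrict measurableSet_Ioi,
      Set.inter_eq_left.2 (Set.Ioi_subset_Ioi (rexpNeg_pos a (l i)).le),
      lintegral_exp_neg_mul_log hx1 (rexpNeg_pos _ _)]
  have hi : ∀ i, ∫⁻ ω, ∑' j, ENNReal.ofReal (rexpNeg (fun k => x k.castSucc) (l i)) *
      f i (Q i j ω) ∂μ =
      ENNReal.ofReal (rexpNeg (affExp 1 a x) (l i)) * ENNReal.ofReal (x (Fin.last m) - 1)⁻¹ := by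
    intro i
    rw [lintegral_tsum fun j => ((hfQ i j).const_mul _).aemeasurable]
    simp_rw [lintegral_const_mul _ (hfQ i _)]
    rw [ENNReal.tsum_mul_left, (hQ i).tsum_lintegral (hfm i), hint,
      ← ENNReal.ofReal_mul (rexpNeg_pos _ _).le, ← ENNReal.ofReal_mul (rexpNeg_pos _ _).le,
      div_eq_mul_inv, ← mul_assoc, rexpNeg_mul_exp_affExp]
  rw [lintegral_tsum fun i => (Measurable.tsum fun j => (hfQ i j).const_mul _).aemeasurable]
  simp_rw [hi]
  rw [ENNReal.tsum_mul_right]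
  exact ENNReal.mul_ne_top (hl _ hx) ENNReal.ofReal_ne_top

end Conditions

/-! ### Exponential integrals over half-lines and orthants -/

lemma integral_Ici_exp_neg {b : ℝ} (hb : 0 < b) (c : ℝ) :
    ∫ t in Set.Ici c, Real.exp (-(b * t)) = Real.exp (-(b * c)) / b := by
  rw [integral_Ici_eq_integral_Ioi]
  have h := integral_exp_mul_Ioi (a := -b) (by linarith) c
  rw [neg_div_neg_eq] at h
  simpa [neg_mul] using h

lemma integrableOn_Ici_exp_neg {b : ℝ} (hb : 0 < b) (c : ℝ) :
    IntegrableOn (fun t => Real.exp (-(b * t))) (Set.Ici c) := by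
  rw [integrableOn_Ici_iff_integrableOn_Ioi]
  simpa [neg_mul] using integrableOn_exp_mul_Ioi (a := -b) (by linarith) c

lemma integrable_exp_neg_mul_abs {b : ℝ} (hb : 0 < b) :
    Integrable (fun t : ℝ => Real.exp (-(b * |t|))) := by
  rw [← integrableOn_univ, ← Set.Iic_union_Ici (a := (0 : ℝ))]
  refine IntegrableOn.union ?_ ?_
  · have h := (integrableOn_Ici_exp_neg hb 0)
    rw [← neg_zero, integrableOn_Ici_iff_integrableOn_Ioi] at h
    have h2 := h.comp_neg_Iio
    rw [← integrableOn_Iic_iff_integrableOn_Iio] at h2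
    refine h2.congr_fun (fun t ht => ?_) measurableSet_Iic
    rw [abs_of_nonpos ht]
  · refine (integrableOn_Ici_exp_neg hb 0).congr_fun (fun t ht => ?_) measurableSet_Ici
    rw [abs_of_nonneg ht]

lemma lintegral_ofReal_prod {m : ℕ} {f : Fin m → ℝ → ℝ} (hf : ∀ k, Integrable (f k))
    (h0 : ∀ k t, 0 ≤ f k t) :
    ∫⁻ τ : Fin m → ℝ, ENNReal.ofReal (∏ k, f k (τ k)) = ENNReal.ofReal (∏ k, ∫ t, f k t) := by
  rw [← integral_fintype_prod_eq_prod (μ := fun _ => volume), ofReal_integral_eq_lintegral_ofReal]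
  · rfl
  · exact Integrable.fintype_prod hf
  · exact ae_of_all _ fun τ => Finset.prod_nonneg fun k _ => h0 k _

lemma indicator_Ici_pi_eq_prod {R : Type*} [CommMonoidWithZero R] {m : ℕ} (l : Fin m → ℝ)
    (f : Fin m → ℝ → R) (τ : Fin m → ℝ) :
    (Set.Ici l).indicator (fun τ => ∏ k, f k (τ k)) τ =
      ∏ k, (Set.Ici (l k)).indicator (f k) (τ k) := by
  classical
  by_cases h : l ≤ τ
  · rw [Set.indicator_of_mem (Set.mem_Ici.2 h)]
    exact Finset.prod_congr rfl fun k _ => (Set.indicator_of_mem (Set.mem_Ici.2 (h k)) _).symm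
  · rw [Set.indicator_of_notMem (by simpa using h)]
    obtain ⟨k, hk⟩ := not_forall.1 h
    exact (Finset.prod_eq_zero (Finset.mem_univ k)
      (Set.indicator_of_notMem (show τ k ∉ Set.Ici (l k) from hk) _)).symm

/-! ### Second moment estimate for the random density -/

section

variable {I : Type*} {m : ℕ}

/-- The normalised sum of the compensated counts over the indices `i` with `l i ≤ p.1`. -/
def compensatedSum (a : Fin m → ℝ) (l : I → Fin m → ℝ) (q : I → ℕ → ℝ)
    (p : (Fin m → ℝ) × ℝ) : ℝ :=
  ∑' i, (Set.Ici (l i)).indicator (fun _ => rexpNeg (fun k => -(a k / 2)) (l i) *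
    compensatedCount (q i) (rexpNeg a (l i)) p.2) p.1

/-- The vector dual to the exponents in the integral representation. -/
def logVec (a : Fin m → ℝ) (p : (Fin m → ℝ) × ℝ) : Fin (m + 1) → ℝ :=
  Fin.snoc p.1 (p.2 - ∑ k, a k * p.1 k)

/-- The measure space of the integral representation. -/
def halfSpaceMeasure (m : ℕ) : Measure ((Fin m → ℝ) × ℝ) :=
  volume.prod (volume.restrict (Set.Ioi 0))

/-- The density of the integral representation. -/
def density (a : Fin m → ℝ) (l : I → Fin m → ℝ) (q : I → ℕ → ℝ) (p : (Fin m → ℝ) × ℝ) : ℝ :=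
  compensatedSum a l q p * rexpNeg (fun k => a k / 2) p.1

/-- The absolute integral of the density against an exponential. -/
def absIntegral (a : Fin m → ℝ) (x : Fin (m + 1) → ℝ) (l : I → Fin m → ℝ) (q : I → ℕ → ℝ) :
    ℝ≥0∞ :=
  ∫⁻ p, ‖density a l q p‖ₑ * ENNReal.ofReal (rexpNeg x (logVec a p)) ∂(halfSpaceMeasure m)

instance : SFinite (halfSpaceMeasure m) := by unfold halfSpaceMeasure; infer_instance

@[fun_prop]
lemma measurable_logVec (a : Fin m → ℝ) : Measurable (logVec a) := by
  refine measurable_pi_lambda _ fun k => ?_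
  refine Fin.lastCases ?_ (fun k => ?_) k
  · simp only [logVec, Fin.snoc_last]; fun_prop
  · simp only [logVec, Fin.snoc_castSucc]; fun_prop

/-- This identity dictates `logVec` and the factor in `density`: the exponent with coefficients x_k
+ a_k(1/2 - x_d) is affine in x, and its part independent of x is moved to the density. -/
lemma rexpNeg_half_mul_logVec (a : Fin m → ℝ) (x : Fin (m + 1) → ℝ) (p : (Fin m → ℝ) × ℝ) :
    rexpNeg (fun k => a k / 2) p.1 * rexpNeg x (logVec a p) =
      rexpNeg (affExp (1 / 2) a x) p.1 * Real.exp (-(x (Fin.last m) * p.2)) := by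
  rw [rexpNeg, rexpNeg, rexpNeg, ← Real.exp_add, ← Real.exp_add, Fin.sum_univ_castSucc]
  congr 1
  simp only [logVec, Fin.snoc_castSucc, Fin.snoc_last, mul_sub, Finset.mul_sum, affExp]
  rw [← neg_add, ← neg_add]
  congr 1
  have h : ∑ k, a k / 2 * p.1 k + ∑ k : Fin m, x k.castSucc * p.1 k -
      ∑ k, x (Fin.last m) * (a k * p.1 k) =
      ∑ k, (x k.castSucc + (a k * (1 / 2) - a k * x (Fin.last m))) * p.1 k := by
    rw [← Finset.sum_add_distrib, ← Finset.sum_sub_distrib]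
    exact Finset.sum_congr rfl fun k _ => by ring
  linarith

variable {Ω : Type*} [MeasurableSpace Ω] {μ : Measure Ω} {Q : I → ℕ → Ω → ℝ}

/-- The number of indices `i` with `l i ≤ τ`. -/
def boxCount (l : I → Fin m → ℝ) (τ : Fin m → ℝ) : ℝ≥0∞ := ∑' i, (Set.Ici (l i)).indicator 1 τ

/-- By orthogonality each of the terms with `l i ≤ τ` contributes e^s - 1, whatever its cutoff. -/
lemma lintegral_compensatedSum_sq_le [IsProbabilityMeasure μ]
    (hQ : ∀ i, IsUnitPoissonPoints (Q i) μ)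
    (hind : iIndepFun (fun i ω j => Q i j ω) μ) (a : Fin m → ℝ) (l : I → Fin m → ℝ)
    (τ : Fin m → ℝ) {s : ℝ} (hs : 0 ≤ s) :
    ∫⁻ ω, ENNReal.ofReal (compensatedSum a l (fun i j => Q i j ω) (τ, s) ^ 2) ∂μ ≤
      boxCount l τ * ENNReal.ofReal (Real.exp s) := by
  classical
  by_cases hfin : {i | l i ≤ τ}.Finite
  · have hsum : ∀ ω, compensatedSum a l (fun i j => Q i j ω) (τ, s) =
        ∑ i ∈ hfin.toFinset, rexpNeg (fun k => -(a k / 2)) (l i) *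
          compensatedCount (fun j => Q i j ω) (rexpNeg a (l i)) s := by
      intro ω
      unfold compensatedSum
      rw [tsum_eq_sum (s := hfin.toFinset)]
      · refine Finset.sum_congr rfl fun i hi => ?_
        rw [Set.indicator_of_mem]
        simpa using hi
      · intro i hi
        rw [Set.indicator_of_notMem]
        simpa using hi
    simp_rw [hsum]
    rw [integral_sum_compensatedCount_sq hQ hind _ _ _ (fun i => (rexpNeg_pos _ _).le) hs]
    have h1 : ∀ i, rexpNeg (fun k => -(a k / 2)) (l i) ^ 2 *
        (rexpNeg a (l i) * (Real.exp s - 1)) = Real.exp s - 1 := by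
      intro i
      rw [← mul_assoc]
      -- The normalising weight is T_i^{-1/2}, so its square cancels the T_i in the variance.
      have : rexpNeg (fun k => -(a k / 2)) (l i) ^ 2 * rexpNeg a (l i) = 1 := by
        rw [rexpNeg, rexpNeg, ← Real.exp_nat_mul, ← Real.exp_add, ← Real.exp_zero]
        congr 1
        rw [← Finset.sum_neg_distrib, Finset.mul_sum, ← Finset.sum_neg_distrib,
          ← Finset.sum_add_distrib]
        refine Finset.sum_eq_zero fun k _ => ?_
        push_cast
        ring
      rw [this, one_mul]
    simp_rw [h1]
    rw [Finset.sum_const, nsmul_eq_mul, ENNReal.ofReal_mul (by positivity), ENNReal.ofReal_natCast]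
    refine mul_le_mul' ?_ (ENNReal.ofReal_le_ofReal (by linarith))
    unfold boxCount
    refine le_trans (le_of_eq ?_) (ENNReal.sum_le_tsum hfin.toFinset)
    rw [Finset.sum_congr rfl (g := fun _ => (1 : ℝ≥0∞))]
    · simp
    · intro i hi
      rw [Set.indicator_of_mem (by simpa using hi), Pi.one_apply]
  -- With infinitely many terms `compensatedSum` may be the default value of a divergent `tsum`, but
  -- then the right-hand side is infinite.
  · have : boxCount l τ = ∞ := by
      unfold boxCount
      have h1 : ∀ i, (Set.Ici (l i)).indicator (1 : (Fin m → ℝ) → ℝ≥0∞) τ =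
          {i | l i ≤ τ}.indicator (fun _ => 1) i := by
        intro i
        simp [Set.indicator_apply]
      simp_rw [h1]
      rw [← tsum_subtype]
      have := Set.infinite_coe_iff.2 hfin
      exact ENNReal.tsum_const_eq_top_of_ne_zero one_ne_zero
    rw [this, ENNReal.top_mul]
    · exact le_top
    · simp [Real.exp_pos]

variable [Countable I]

lemma measurable_compensatedSum {α : Type*} [MeasurableSpace α] (a : Fin m → ℝ)
    {l : α → I → Fin m → ℝ} {q : α → I → ℕ → ℝ} {p : α → (Fin m → ℝ) × ℝ} (hl : Measurable l)
    (hq : Measurable q) (hp : Measurable p) :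
    Measurable fun x => compensatedSum a (l x) (q x) (p x) := by
  unfold compensatedSum
  refine Measurable.tsum fun i => ?_
  have h1 : Measurable fun x => l x i := (measurable_pi_apply i).comp hl
  have h2 : Measurable fun x => q x i := (measurable_pi_apply i).comp hq
  have : (fun x => (Set.Ici (l x i)).indicator (fun _ => rexpNeg (fun k => -(a k / 2)) (l x i) *
      compensatedCount (q x i) (rexpNeg a (l x i)) (p x).2) (p x).1) =
      {x | l x i ≤ (p x).1}.indicator fun x => rexpNeg (fun k => -(a k / 2)) (l x i) *
        compensatedCount (q x i) (rexpNeg a (l x i)) (p x).2 := by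
    ext x
    by_cases h : l x i ≤ (p x).1
    · rw [Set.indicator_of_mem (Set.mem_Ici.2 h), Set.indicator_of_mem (by exact h)]
    · rw [Set.indicator_of_notMem (by simpa using h), Set.indicator_of_notMem (by exact h)]
  rw [this]
  refine Measurable.indicator ?_ (measurableSet_le h1 hp.fst)
  exact (measurable_rexpNeg _ h1).mul
    (measurable_compensatedCount h2 (measurable_rexpNeg a h1) hp.snd)

lemma measurable_density {α : Type*} [MeasurableSpace α] (a : Fin m → ℝ)
    {l : α → I → Fin m → ℝ} {q : α → I → ℕ → ℝ} {p : α → (Fin m → ℝ) × ℝ} (hl : Measurable l)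
    (hq : Measurable q) (hp : Measurable p) :
    Measurable fun x => density a (l x) (q x) (p x) :=
  (measurable_compensatedSum a hl hq hp).mul (measurable_rexpNeg _ hp.fst)

lemma measurable_absIntegral (a : Fin m → ℝ) (x : Fin (m + 1) → ℝ) :
    Measurable (Function.uncurry (absIntegral (I := I) a x)) := by
  unfold absIntegral Function.uncurry
  refine Measurable.lintegral_prod_right' (f := fun r : ((I → Fin m → ℝ) × (I → ℕ → ℝ)) ×
    ((Fin m → ℝ) × ℝ) => ‖density a r.1.1 r.1.2 r.2‖ₑ *
      ENNReal.ofReal (rexpNeg x (logVec a r.2))) ?_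
  refine Measurable.mul ?_
    (measurable_rexpNeg x ((measurable_logVec a).comp measurable_snd)).ennreal_ofReal
  exact (measurable_density a (measurable_fst.comp measurable_fst)
    (measurable_snd.comp measurable_fst) measurable_snd).enorm

/-- Termwise, integration of the product over τ ≥ l i reproduces the product at `l i` up to the
factor 2^m, so finiteness is inherited from the exponential sum. -/
lemma lintegral_boxCount_mul_ne_top {y : Fin m → ℝ} {r : ℝ} (hr : r ≤ 1 / 2)
    (hy : ∀ k, 1 < y k) (hr0 : 0 < r) {l : I → Fin m → ℝ}
    (hfin : ∑' i, ENNReal.ofReal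
      (∏ k, (Real.exp (-((y k - r) * l i k)) + Real.exp (-((y k + r) * l i k)))) ≠ ∞) :
    ∫⁻ τ, boxCount l τ * ENNReal.ofReal
      (∏ k, (Real.exp (-((y k - r) * τ k)) + Real.exp (-((y k + r) * τ k)))) ≠ ∞ := by
  set f : Fin m → ℝ → ℝ := fun k t => Real.exp (-((y k - r) * t)) + Real.exp (-((y k + r) * t))
    with hf
  have hf0 : ∀ k t, 0 ≤ f k t := fun k t => by positivity
  have hfi : ∀ k c, IntegrableOn (f k) (Set.Ici c) := fun k c =>
    (integrableOn_Ici_exp_neg (by linarith [hy k]) c).add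
      (integrableOn_Ici_exp_neg (by linarith [hy k]) c)
  have hint : ∀ k c, ∫ t, (Set.Ici c).indicator (f k) t ≤ 2 * f k c := by
    intro k c
    -- All rates are at least 1/2, so dividing by them costs at most a factor 2 per coordinate.
    have b1 : (1 / 2 : ℝ) ≤ y k - r := by linarith [hy k]
    have b2 : (1 / 2 : ℝ) ≤ y k + r := by linarith [hy k]
    rw [integral_indicator measurableSet_Ici, hf]
    dsimp only
    rw [integral_add (integrableOn_Ici_exp_neg (by linarith) c)
      (integrableOn_Ici_exp_neg (by linarith) c), integral_Ici_exp_neg (by linarith),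
      integral_Ici_exp_neg (by linarith), mul_add]
    refine add_le_add ?_ ?_
    · rw [div_le_iff₀ (by linarith)]; nlinarith [Real.exp_pos (-((y k - r) * c))]
    · rw [div_le_iff₀ (by linarith)]; nlinarith [Real.exp_pos (-((y k + r) * c))]
  have hi : ∀ i, ∫⁻ τ, (Set.Ici (l i)).indicator 1 τ * ENNReal.ofReal (∏ k, f k (τ k)) ≤
      ENNReal.ofReal (2 ^ m) * ENNReal.ofReal (∏ k, f k (l i k)) := by
    intro i
    have h1 : ∀ τ : Fin m → ℝ, (Set.Ici (l i)).indicator 1 τ * ENNReal.ofReal (∏ k, f k (τ k)) =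
        ENNReal.ofReal (∏ k, (Set.Ici (l i k)).indicator (f k) (τ k)) := by
      intro τ
      rw [← indicator_Ici_pi_eq_prod]
      by_cases h : τ ∈ Set.Ici (l i) <;> simp [h]
    simp_rw [h1]
    rw [lintegral_ofReal_prod (f := fun k => (Set.Ici (l i k)).indicator (f k))
      (fun k => (integrable_indicator_iff measurableSet_Ici).2 (hfi k _))
      (fun k t => Set.indicator_nonneg (fun t _ => hf0 k t) t), ← ENNReal.ofReal_mul (by positivity)]
    refine ENNReal.ofReal_le_ofReal ?_
    refine (Finset.prod_le_prod (fun k _ => ?_) fun k _ => hint k (l i k)).trans (le_of_eq ?_)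
    · exact integral_nonneg fun t => Set.indicator_nonneg (fun t _ => hf0 k t) t
    · rw [Finset.prod_mul_distrib]; simp
  unfold boxCount
  simp_rw [← ENNReal.tsum_mul_right]
  have hfm : Measurable fun τ : Fin m → ℝ => ENNReal.ofReal (∏ k, f k (τ k)) := by
    rw [hf]; fun_prop
  rw [lintegral_tsum (f := fun i τ => (Set.Ici (l i)).indicator 1 τ *
    ENNReal.ofReal (∏ k, f k (τ k))) fun i => ((measurable_one.indicator measurableSet_Ici).mul hfm).aemeasurable]
  refine ne_top_of_le_ne_top ?_ (ENNReal.tsum_le_tsum hi)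
  rw [ENNReal.tsum_mul_left]
  exact ENNReal.mul_ne_top ENNReal.ofReal_ne_top hfin

lemma measurable_boxCount (l : I → Fin m → ℝ) : Measurable (boxCount l) :=
  Measurable.tsum fun _ => measurable_one.indicator measurableSet_Ici

/-- The first moment of the compensated sum is replaced by its second moment through a weighted
AM-GM inequality. Squaring doubles the exponents, which explains the hypotheses x_d > 1/2 and 2 ·
`affExp (1 / 2) a x` in the m-level domain. -/
lemma lintegral_absIntegral_ne_top [IsProbabilityMeasure μ]
    (hQ : ∀ i, IsUnitPoissonPoints (Q i) μ)
    (hind : iIndepFun (fun i ω j => Q i j ω) μ) {a : Fin m → ℝ} {x : Fin (m + 1) → ℝ}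
    (hx1 : 1 / 2 < x (Fin.last m)) (hx : (fun k => 2 * affExp (1 / 2) a x k) ∈ realDomain m 1)
    {l : I → Fin m → ℝ} (hl : FiniteExpSums l) :
    ∫⁻ ω, absIntegral a x l (fun i j => Q i j ω) ∂μ ≠ ∞ := by
  -- Sums over `I` are treated as integrals against counting measure.
  let _ : MeasurableSpace I := ⊤
  set y : Fin m → ℝ := fun k => 2 * affExp (1 / 2) a x k with hy
  obtain ⟨r, hr0, hr, hfin⟩ := lintegral_prod_add_exp_ne_top (ν := Measure.count)
    (h := fun _ : I => 1) aemeasurable_const (l := l) measurable_from_top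
    (isOpen_realDomain m 1) (fun q hq => by simpa [lintegral_count] using hl _ hq) hx
  simp only [one_mul, lintegral_count] at hfin
  -- Chosen so that 2 x_d = 1 + 2ε: one unit pays for the factor e^s in the second moment, one ε for
  -- the weight `ρ`, and one ε is left for convergence in `s`.
  set ε : ℝ := (2 * x (Fin.last m) - 1) / 2 with hε
  have hε0 : 0 < ε := by rw [hε]; linarith
  set G : (Fin m → ℝ) → ℝ := fun τ =>
    ∏ k, (Real.exp (-((y k - r) * τ k)) + Real.exp (-((y k + r) * τ k))) with hG
  have hGm : Measurable G := by rw [hG]; fun_prop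
  -- A weight whose inverse is integrable over the half-space and which `E ^ 2` can absorb, thanks
  -- to the margin `r` in τ and ε in `s`.
  set ρ : (Fin m → ℝ) → ℝ → ℝ := fun τ s => Real.exp (r * ∑ k, |τ k| + ε * s) with hρ
  have hpt : ∀ (A : ℝ) (τ : Fin m → ℝ) (s : ℝ),
      |A| * (rexpNeg (affExp (1 / 2) a x) τ * Real.exp (-(x (Fin.last m) * s))) ≤
        A ^ 2 * (G τ * Real.exp (-((1 + ε) * s))) + Real.exp (-(r * ∑ k, |τ k|)) *
          Real.exp (-(ε * s)) := by
    intro A τ s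
    set E := rexpNeg (affExp (1 / 2) a x) τ * Real.exp (-(x (Fin.last m) * s)) with hE
    have hE0 : 0 < E := mul_pos (rexpNeg_pos _ _) (Real.exp_pos _)
    have hρ0 : 0 < ρ τ s := Real.exp_pos _
    have h1 : E ^ 2 * ρ τ s ≤ G τ * Real.exp (-((1 + ε) * s)) := by
      have h2 := rexpNeg_mul_exp_le y τ r
      have h3 : E ^ 2 * ρ τ s = rexpNeg y τ * Real.exp (r * ∑ k, |τ k|) *
          Real.exp (-((1 + ε) * s)) := by
        rw [hE, hρ, rexpNeg, rexpNeg]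
        dsimp only
        rw [← Real.exp_add, ← Real.exp_add, ← Real.exp_add, ← Real.exp_nat_mul, ← Real.exp_add]
        congr 1
        rw [hy, hε]
        simp only [mul_assoc, ← Finset.mul_sum]
        push_cast
        ring
      rw [h3]
      gcongr
    have h4 : Real.exp (-(r * ∑ k, |τ k|)) * Real.exp (-(ε * s)) = (ρ τ s)⁻¹ := by
      rw [hρ, ← Real.exp_neg, ← Real.exp_add]
      congr 1
      ring
    rw [h4]
    -- With u = |A| E ρ this is u ≤ u² + 1, divided by `ρ`.
    have h5 : |A| * E ≤ A ^ 2 * (E ^ 2 * ρ τ s) + (ρ τ s)⁻¹ := by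
      rw [← sq_abs A, ← sub_nonneg]
      have : |A| ^ 2 * (E ^ 2 * ρ τ s) + (ρ τ s)⁻¹ - |A| * E =
          (ρ τ s)⁻¹ * ((|A| * E * ρ τ s - 1 / 2) ^ 2 + 3 / 4) := by
        field_simp
        ring
      rw [this]
      positivity
    refine h5.trans ?_
    gcongr
  have hmQ : Measurable fun ω i j => Q i j ω :=
    measurable_pi_lambda _ fun i => measurable_pi_lambda _ fun j => (hQ i).measurable j
  have hle : ∀ ω (p : (Fin m → ℝ) × ℝ),
      ‖density a l (fun i j => Q i j ω) p‖ₑ * ENNReal.ofReal (rexpNeg x (logVec a p)) ≤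
        ENNReal.ofReal (compensatedSum a l (fun i j => Q i j ω) p ^ 2) *
          ENNReal.ofReal (G p.1 * Real.exp (-((1 + ε) * p.2))) +
        ENNReal.ofReal (Real.exp (-(r * ∑ k, |p.1 k|))) *
          ENNReal.ofReal (Real.exp (-(ε * p.2))) := by
    intro ω p
    have hG0 : 0 ≤ G p.1 := by positivity
    rw [density, ← ofReal_norm, ← ENNReal.ofReal_mul (norm_nonneg _),
      ← ENNReal.ofReal_mul (sq_nonneg _), ← ENNReal.ofReal_mul (Real.exp_pos _).le,
      ← ENNReal.ofReal_add (by positivity) (by positivity), norm_mul, Real.norm_eq_abs,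
      Real.norm_of_nonneg (rexpNeg_pos _ _).le, mul_assoc, rexpNeg_half_mul_logVec]
    exact ENNReal.ofReal_le_ofReal (hpt _ _ _)
  unfold absIntegral
  rw [lintegral_lintegral_swap]
  swap
  · refine Measurable.aemeasurable ?_
    have h1 : Measurable fun z : Ω × ((Fin m → ℝ) × ℝ) => density a l (fun i j => Q i j z.1) z.2 :=
      measurable_density a measurable_const (hmQ.comp measurable_fst) measurable_snd
    exact h1.enorm.mul (by fun_prop)
  have hbound : ∀ᵐ p ∂(halfSpaceMeasure m), ∫⁻ ω, ‖density a l (fun i j => Q i j ω) p‖ₑ *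
        ENNReal.ofReal (rexpNeg x (logVec a p)) ∂μ ≤
      (boxCount l p.1 * ENNReal.ofReal (G p.1)) * ENNReal.ofReal (Real.exp (-(ε * p.2))) +
        ENNReal.ofReal (Real.exp (-(r * ∑ k, |p.1 k|))) *
          ENNReal.ofReal (Real.exp (-(ε * p.2))) := by
    have hp : ∀ᵐ p ∂(halfSpaceMeasure m), p.2 ∈ Set.Ioi (0 : ℝ) := by
      unfold halfSpaceMeasure
      exact Measure.quasiMeasurePreserving_snd.ae (ae_restrict_mem measurableSet_Ioi)
    filter_upwards [hp] with p hp
    have hcm : Measurable fun ω => compensatedSum a l (fun i j => Q i j ω) p :=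
      measurable_compensatedSum a measurable_const hmQ measurable_const
    refine (lintegral_mono fun ω => hle ω p).trans ?_
    rw [lintegral_add_right _ measurable_const, lintegral_mul_const _ (by fun_prop),
      lintegral_const, measure_univ, mul_one]
    refine add_le_add ?_ le_rfl
    refine (mul_le_mul_left (lintegral_compensatedSum_sq_le hQ hind a l p.1
      (le_of_lt hp)) _).trans (le_of_eq ?_)
    have hG0 : 0 ≤ G p.1 := by positivity
    rw [mul_assoc, mul_assoc, ← ENNReal.ofReal_mul (Real.exp_pos _).le,
      ← ENNReal.ofReal_mul hG0, mul_left_comm, ← Real.exp_add]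
    congr 4
    ring
  refine ne_top_of_le_ne_top ?_ (lintegral_mono_ae hbound)
  have hε1 : ∫⁻ s in Set.Ioi (0 : ℝ), ENNReal.ofReal (Real.exp (-(ε * s))) ≠ ∞ := by
    have h := (integrableOn_Ici_exp_neg hε0 0)
    rw [integrableOn_Ici_iff_integrableOn_Ioi] at h
    exact ((hasFiniteIntegral_iff_ofReal (ae_of_all _ fun s => (Real.exp_pos _).le)).1 h.2).ne
  have hr1 : ∫⁻ τ : Fin m → ℝ, ENNReal.ofReal (Real.exp (-(r * ∑ k, |τ k|))) ≠ ∞ := by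
    have h1 : ∀ τ : Fin m → ℝ, Real.exp (-(r * ∑ k, |τ k|)) = ∏ k, Real.exp (-(r * |τ k|)) := by
      intro τ
      rw [← Real.exp_sum, Finset.sum_neg_distrib, Finset.mul_sum]
    simp_rw [h1]
    rw [lintegral_ofReal_prod (f := fun _ t => Real.exp (-(r * |t|)))
      (fun _ => integrable_exp_neg_mul_abs hr0) fun _ _ => (Real.exp_pos _).le]
    exact ENNReal.ofReal_ne_top
  have hm1 : Measurable fun τ => boxCount l τ * ENNReal.ofReal (G τ) :=
    (measurable_boxCount l).mul hGm.ennreal_ofReal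
  have hm2 : Continuous fun τ : Fin m → ℝ => Real.exp (-(r * ∑ k, |τ k|)) := by fun_prop
  unfold halfSpaceMeasure
  rw [lintegral_add_left (f := fun p : (Fin m → ℝ) × ℝ => boxCount l p.1 *
    ENNReal.ofReal (G p.1) * ENNReal.ofReal (Real.exp (-(ε * p.2)))) ((hm1.comp measurable_fst).mul (by fun_prop)),
    lintegral_prod_mul (f := fun τ => boxCount l τ * ENNReal.ofReal (G τ))
      (g := fun s => ENNReal.ofReal (Real.exp (-(ε * s)))) hm1.aemeasurable (by fun_prop),
    lintegral_prod_mul (μ := volume) (ν := volume.restrict (Set.Ioi 0))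
      (f := fun τ : Fin m → ℝ => ENNReal.ofReal (Real.exp (-(r * ∑ k, |τ k|))))
      (g := fun s => ENNReal.ofReal (Real.exp (-(ε * s))))
      hm2.measurable.ennreal_ofReal.aemeasurable (by fun_prop)]
  refine ENNReal.add_ne_top.2 ⟨ENNReal.mul_ne_top ?_ hε1, ENNReal.mul_ne_top hr1 hε1⟩
  exact lintegral_boxCount_mul_ne_top hr hx.2 hr0 hfin

end

/-! ### Summation by parts above a cutoff -/

lemma integral_Ici_cexp_neg {z : ℂ} (hz : 0 < z.re) (c : ℝ) :
    ∫ t in Set.Ici c, Complex.exp (-(z * t)) = Complex.exp (-(z * c)) / z := by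
  rw [integral_Ici_eq_integral_Ioi]
  have h := integral_exp_mul_complex_Ioi (a := -z) (by simpa using hz) c
  rw [neg_div_neg_eq] at h
  simpa [neg_mul] using h

lemma integrableOn_Ici_cexp_neg {z : ℂ} (hz : 0 < z.re) (c : ℝ) :
    IntegrableOn (fun t : ℝ => Complex.exp (-(z * t))) (Set.Ici c) := by
  rw [integrableOn_Ici_iff_integrableOn_Ioi]
  simpa [neg_mul] using integrableOn_exp_mul_complex_Ioi (a := -z) (by simpa using hz) c

lemma lintegral_Ici_exp_neg {b : ℝ} (hb : 0 < b) (c : ℝ) :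
    ∫⁻ t in Set.Ici c, ENNReal.ofReal (Real.exp (-(b * t))) =
      ENNReal.ofReal (Real.exp (-(b * c)) / b) := by
  rw [← ofReal_integral_eq_lintegral_ofReal (integrableOn_Ici_exp_neg hb c)
    (ae_of_all _ fun t => (Real.exp_pos _).le), integral_Ici_exp_neg hb]

lemma enorm_ofReal_complex (x : ℝ) : ‖(x : ℂ)‖ₑ = ‖x‖ₑ := by
  rw [← ofReal_norm, Complex.norm_real, ofReal_norm]

lemma enorm_cexp_neg_mul (z : ℂ) (t : ℝ) :
    ‖Complex.exp (-(z * t))‖ₑ = ENNReal.ofReal (Real.exp (-(z.re * t))) := by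
  rw [← ofReal_norm, Complex.norm_exp]
  simp

section

variable {θ u : ℝ}

/-- A point above the cutoff enters the growing window at s = log u - θ and stays, so as a function
of `s` it is the indicator of a half-line. -/
lemma indicator_Ioc_of_lt (h : Real.exp θ < u) (s : ℝ) :
    (Set.Ioc (Real.exp θ) (Real.exp θ * Real.exp s)).indicator (1 : ℝ → ℝ≥0∞) u =
      (Set.Ici (Real.log u - θ)).indicator 1 s := by
  have hu : 0 < u := (Real.exp_pos θ).trans h
  have : u ∈ Set.Ioc (Real.exp θ) (Real.exp θ * Real.exp s) ↔ s ∈ Set.Ici (Real.log u - θ) := by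
    rw [← Real.exp_add, Set.mem_Ioc, Set.mem_Ici, sub_le_iff_le_add', Real.log_le_iff_le_exp hu]
    exact ⟨fun h => h.2, fun h' => ⟨h, h'⟩⟩
  by_cases hm : s ∈ Set.Ici (Real.log u - θ)
  · rw [Set.indicator_of_mem hm, Set.indicator_of_mem (this.2 hm), Pi.one_apply, Pi.one_apply]
  · rw [Set.indicator_of_notMem hm, Set.indicator_of_notMem (mt this.1 hm)]

lemma indicator_Ioc_of_not_lt (h : ¬ Real.exp θ < u) (s : ℝ) :
    (Set.Ioc (Real.exp θ) (Real.exp θ * Real.exp s)).indicator (1 : ℝ → ℝ≥0∞) u = 0 :=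
  Set.indicator_of_notMem (fun hm => h hm.1) _

lemma Ici_log_sub_subset (h : Real.exp θ < u) : Set.Ici (Real.log u - θ) ⊆ Set.Ioi 0 := by
  intro s hs
  have : θ < Real.log u := (Real.lt_log_iff_exp_lt ((Real.exp_pos θ).trans h)).2 h
  exact lt_of_lt_of_le (by linarith) (Set.mem_Ici.1 hs)

lemma lintegral_indicator_Ioc {x : ℝ} (hx : 0 < x) :
    ∫⁻ s in Set.Ioi (0 : ℝ), (Set.Ioc (Real.exp θ) (Real.exp θ * Real.exp s)).indicator
        (1 : ℝ → ℝ≥0∞) u * ENNReal.ofReal (Real.exp (-(x * s))) =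
      ENNReal.ofReal (Real.exp (x * θ) / x) * (Set.Ioi (Real.exp θ)).indicator
        (fun t => ENNReal.ofReal (Real.exp (-(x * Real.log t)))) u := by
  by_cases h : Real.exp θ < u
  · rw [Set.indicator_of_mem (show u ∈ Set.Ioi (Real.exp θ) from h)]
    simp_rw [indicator_Ioc_of_lt h]
    have : ∀ s, (Set.Ici (Real.log u - θ)).indicator (1 : ℝ → ℝ≥0∞) s *
        ENNReal.ofReal (Real.exp (-(x * s))) = (Set.Ici (Real.log u - θ)).indicator
          (fun s => ENNReal.ofReal (Real.exp (-(x * s)))) s := by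
      intro s
      by_cases hm : s ∈ Set.Ici (Real.log u - θ) <;> simp [hm]
    simp_rw [this]
    rw [lintegral_indicator measurableSet_Ici, Measure.restrict_restrict measurableSet_Ici,
      Set.inter_eq_left.2 (Ici_log_sub_subset h), lintegral_Ici_exp_neg hx,
      ← ENNReal.ofReal_mul (by positivity), div_mul_eq_mul_div, ← Real.exp_add]
    congr 3
    ring
  · rw [Set.indicator_of_notMem (show u ∉ Set.Ioi (Real.exp θ) from h)]
    simp_rw [indicator_Ioc_of_not_lt h]
    simp

lemma integral_indicator_Ioc {z : ℂ} (hz : 0 < z.re) :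
    ∫ s in Set.Ioi (0 : ℝ), ((((Set.Ioc (Real.exp θ) (Real.exp θ * Real.exp s)).indicator
        (1 : ℝ → ℝ≥0∞) u).toReal : ℝ) : ℂ) * Complex.exp (-(z * s)) =
      Complex.exp (z * θ) / z * (Set.Ioi (Real.exp θ)).indicator
        (fun t => Complex.exp (-(z * Real.log t))) u := by
  by_cases h : Real.exp θ < u
  · rw [Set.indicator_of_mem (show u ∈ Set.Ioi (Real.exp θ) from h)]
    simp_rw [indicator_Ioc_of_lt h]
    have : ∀ s, ((((Set.Ici (Real.log u - θ)).indicator (1 : ℝ → ℝ≥0∞) s).toReal : ℝ) : ℂ) *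
        Complex.exp (-(z * s)) = (Set.Ici (Real.log u - θ)).indicator
          (fun s : ℝ => Complex.exp (-(z * s))) s := by
      intro s
      by_cases hm : s ∈ Set.Ici (Real.log u - θ) <;> simp [hm]
    simp_rw [this]
    rw [integral_indicator measurableSet_Ici, Measure.restrict_restrict measurableSet_Ici,
      Set.inter_eq_left.2 (Ici_log_sub_subset h), integral_Ici_cexp_neg hz,
      div_mul_eq_mul_div, ← Complex.exp_add]
    congr 2
    push_cast
    ring
  · rw [Set.indicator_of_notMem (show u ∉ Set.Ioi (Real.exp θ) from h)]
    simp_rw [indicator_Ioc_of_not_lt h]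
    simp

lemma measurable_indicator_Ioc (θ u : ℝ) :
    Measurable fun s => (Set.Ioc (Real.exp θ) (Real.exp θ * Real.exp s)).indicator
      (1 : ℝ → ℝ≥0∞) u := by
  have : (fun s => (Set.Ioc (Real.exp θ) (Real.exp θ * Real.exp s)).indicator
      (1 : ℝ → ℝ≥0∞) u) =
      {s | Real.exp θ < u ∧ u ≤ Real.exp θ * Real.exp s}.indicator 1 := by
    ext s
    simp [Set.indicator_apply]
  rw [this]
  refine measurable_one.indicator ?_
  exact (MeasurableSet.const _).inter
    (measurableSet_le measurable_const (Real.measurable_exp.const_mul _))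

end

section

variable {q : ℕ → ℝ} {θ : ℝ}

lemma lintegral_pointCount_mul_exp {x : ℝ} (hx : 0 < x) :
    ∫⁻ s in Set.Ioi (0 : ℝ), pointCount q (Set.Ioc (Real.exp θ) (Real.exp θ * Real.exp s)) *
        ENNReal.ofReal (Real.exp (-(x * s))) =
      ENNReal.ofReal (Real.exp (x * θ) / x) * ∑' j, (Set.Ioi (Real.exp θ)).indicator
        (fun t => ENNReal.ofReal (Real.exp (-(x * Real.log t)))) (q j) := by
  unfold pointCount
  simp_rw [← ENNReal.tsum_mul_right]
  rw [lintegral_tsum (f := fun j s => (Set.Ioc (Real.exp θ) (Real.exp θ * Real.exp s)).indicator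
    (1 : ℝ → ℝ≥0∞) (q j) * ENNReal.ofReal (Real.exp (-(x * s)))) fun j =>
    ((measurable_indicator_Ioc θ (q j)).mul (by fun_prop)).aemeasurable]
  simp_rw [lintegral_indicator_Ioc hx]
  rw [ENNReal.tsum_mul_left]

/-- The count and its compensator are bounded separately, without cancellation. This needs x > 1 and
serves only to justify interchanges inside the domain of convergence. -/
lemma lintegral_compensatedCount_mul_exp_le {x : ℝ} (hx : 1 < x) :
    ∫⁻ s in Set.Ioi (0 : ℝ), ‖compensatedCount q (Real.exp θ) s‖ₑ *
        ENNReal.ofReal (Real.exp (-(x * s))) ≤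
      ENNReal.ofReal (Real.exp (x * θ) / x) * ∑' j, (Set.Ioi (Real.exp θ)).indicator
        (fun t => ENNReal.ofReal (Real.exp (-(x * Real.log t)))) (q j) +
      ENNReal.ofReal (Real.exp θ / (x - 1)) := by
  have h1 : ∀ s ∈ Set.Ioi (0 : ℝ), ‖compensatedCount q (Real.exp θ) s‖ₑ *
      ENNReal.ofReal (Real.exp (-(x * s))) ≤
      pointCount q (Set.Ioc (Real.exp θ) (Real.exp θ * Real.exp s)) *
        ENNReal.ofReal (Real.exp (-(x * s))) +
      ENNReal.ofReal (Real.exp θ) * ENNReal.ofReal (Real.exp (-((x - 1) * s))) := by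
    intro s hs
    have h2 : ENNReal.ofReal (Real.exp θ) * ENNReal.ofReal (Real.exp (-((x - 1) * s))) =
        ENNReal.ofReal (Real.exp θ * Real.exp s) * ENNReal.ofReal (Real.exp (-(x * s))) := by
      have : Real.exp (-((x - 1) * s)) = Real.exp s * Real.exp (-(x * s)) := by
        rw [← Real.exp_add]; congr 1; ring
      rw [← ENNReal.ofReal_mul (Real.exp_pos _).le, ← ENNReal.ofReal_mul (by positivity),
        mul_assoc, this]
    rw [h2, ← add_mul]
    gcongr
    unfold compensatedCount
    refine (enorm_sub_le).trans (add_le_add ?_ ?_)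
    · rw [Real.enorm_of_nonneg ENNReal.toReal_nonneg]
      exact ENNReal.ofReal_toReal_le
    · have h3 := Real.one_le_exp (le_of_lt hs)
      rw [Real.enorm_of_nonneg (mul_nonneg (Real.exp_pos _).le (by linarith))]
      refine ENNReal.ofReal_le_ofReal ?_
      gcongr
      linarith
  refine (setLIntegral_mono' measurableSet_Ioi h1).trans (le_of_eq ?_)
  rw [lintegral_add_right _ (by fun_prop), lintegral_pointCount_mul_exp (by linarith),
    lintegral_const_mul _ (by fun_prop)]
  congr 1
  rw [Measure.restrict_congr_set Ioi_ae_eq_Ici, lintegral_Ici_exp_neg (by linarith), mul_zero, neg_zero,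
    Real.exp_zero, ← ENNReal.ofReal_mul (Real.exp_pos _).le, mul_one_div]

variable {z : ℂ}

lemma integrableOn_compensatedCount_mul_exp (hz : 1 < z.re)
    (hsum : ∑' j, (Set.Ioi (Real.exp θ)).indicator
      (fun t => ENNReal.ofReal (Real.exp (-(z.re * Real.log t)))) (q j) ≠ ∞) :
    IntegrableOn (fun s : ℝ => (compensatedCount q (Real.exp θ) s : ℂ) * Complex.exp (-(z * s)))
      (Set.Ioi 0) := by
  refine ⟨Measurable.aestronglyMeasurable ?_, ?_⟩
  · have h : Measurable fun s => compensatedCount q (Real.exp θ) s :=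
      measurable_compensatedCount measurable_const measurable_const measurable_id
    fun_prop
  · rw [hasFiniteIntegral_iff_enorm]
    simp_rw [enorm_mul, enorm_cexp_neg_mul, enorm_ofReal_complex]
    refine lt_of_le_of_lt (lintegral_compensatedCount_mul_exp_le hz) (lt_top_iff_ne_top.2 ?_)
    exact ENNReal.add_ne_top.2
      ⟨ENNReal.mul_ne_top ENNReal.ofReal_ne_top hsum, ENNReal.ofReal_ne_top⟩

/-- Each point u above e^θ contributes the integral of e^{-zs} over s ≥ log u - θ, which is e^{zθ}
u^{-z} / z. -/
lemma integral_pointCount_mul_exp (hz : 1 < z.re)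
    (hsum : ∑' j, (Set.Ioi (Real.exp θ)).indicator
      (fun t => ENNReal.ofReal (Real.exp (-(z.re * Real.log t)))) (q j) ≠ ∞) :
    ∫ s in Set.Ioi (0 : ℝ),
        ((pointCount q (Set.Ioc (Real.exp θ) (Real.exp θ * Real.exp s))).toReal : ℂ) *
          Complex.exp (-(z * s)) =
      Complex.exp (z * θ) / z * ∑' j, (Set.Ioi (Real.exp θ)).indicator
        (fun t => Complex.exp (-(z * Real.log t))) (q j) := by
  have hz0 : 0 < z.re := by linarith
  have h1 : ∀ s : ℝ,
      ((pointCount q (Set.Ioc (Real.exp θ) (Real.exp θ * Real.exp s))).toReal : ℂ) *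
        Complex.exp (-(z * s)) =
      ∑' j, ((((Set.Ioc (Real.exp θ) (Real.exp θ * Real.exp s)).indicator
        (1 : ℝ → ℝ≥0∞) (q j)).toReal : ℝ) : ℂ) * Complex.exp (-(z * s)) := by
    intro s
    rw [tsum_mul_right, pointCount, ENNReal.tsum_toReal_eq, Complex.ofReal_tsum]
    intro j
    refine ne_top_of_le_ne_top ENNReal.one_ne_top (Set.indicator_le_self' (fun _ _ => ?_) _)
    exact zero_le
  simp_rw [h1]
  have hm : ∀ j, Measurable fun s : ℝ =>
      ((((Set.Ioc (Real.exp θ) (Real.exp θ * Real.exp s)).indicator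
        (1 : ℝ → ℝ≥0∞) (q j)).toReal : ℝ) : ℂ) * Complex.exp (-(z * s)) := by
    intro j
    have := measurable_indicator_Ioc θ (q j)
    fun_prop
  rw [integral_tsum (fun j => (hm j).aestronglyMeasurable)]
  · simp_rw [integral_indicator_Ioc hz0]
    rw [tsum_mul_left]
  · have h2 : ∀ j, ∫⁻ s in Set.Ioi (0 : ℝ),
        ‖((((Set.Ioc (Real.exp θ) (Real.exp θ * Real.exp s)).indicator
          (1 : ℝ → ℝ≥0∞) (q j)).toReal : ℝ) : ℂ) * Complex.exp (-(z * s))‖ₑ =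
        ENNReal.ofReal (Real.exp (z.re * θ) / z.re) * (Set.Ioi (Real.exp θ)).indicator
          (fun t => ENNReal.ofReal (Real.exp (-(z.re * Real.log t)))) (q j) := by
      intro j
      rw [← lintegral_indicator_Ioc hz0]
      refine lintegral_congr fun s => ?_
      rw [enorm_mul, enorm_cexp_neg_mul, enorm_ofReal_complex,
        Real.enorm_of_nonneg ENNReal.toReal_nonneg, ENNReal.ofReal_toReal]
      refine ne_top_of_le_ne_top ENNReal.one_ne_top (Set.indicator_le_self' (fun _ _ => ?_) _)
      exact zero_le
    simp_rw [h2]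
    rw [ENNReal.tsum_mul_left]
    exact ENNReal.mul_ne_top ENNReal.ofReal_ne_top hsum

/-- Summation by parts for the points of `q` above `exp θ`. -/
lemma tsum_indicator_cexp_eq (hz : 1 < z.re)
    (hsum : ∑' j, (Set.Ioi (Real.exp θ)).indicator
      (fun t => ENNReal.ofReal (Real.exp (-(z.re * Real.log t)))) (q j) ≠ ∞) :
    ∑' j, (Set.Ioi (Real.exp θ)).indicator (fun t => Complex.exp (-(z * Real.log t))) (q j) =
      Complex.exp ((1 - z) * θ) / (z - 1) + z * Complex.exp (-(z * θ)) *
        ∫ s in Set.Ioi (0 : ℝ),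
          (compensatedCount q (Real.exp θ) s : ℂ) * Complex.exp (-(z * s)) := by
  have hz0 : 0 < z.re := by linarith
  have hzne : z ≠ 0 := fun h => by simp [h] at hz0
  have hz1 : z - 1 ≠ 0 := fun h => by
    rw [sub_eq_zero] at h
    simp [h] at hz
  have hre : 0 < (z - 1).re := by simpa using hz
  have i1 : IntegrableOn (fun s : ℝ => Complex.exp (-((z - 1) * s))) (Set.Ioi 0) :=
    (integrableOn_Ici_cexp_neg hre 0).mono_set Set.Ioi_subset_Ici_self
  have i2 : IntegrableOn (fun s : ℝ => Complex.exp (-(z * s))) (Set.Ioi 0) :=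
    (integrableOn_Ici_cexp_neg hz0 0).mono_set Set.Ioi_subset_Ici_self
  have v1 : ∫ s in Set.Ioi (0 : ℝ), Complex.exp (-((z - 1) * s)) = 1 / (z - 1) := by
    rw [← integral_Ici_eq_integral_Ioi, integral_Ici_cexp_neg hre]
    simp
  have v2 : ∫ s in Set.Ioi (0 : ℝ), Complex.exp (-(z * s)) = 1 / z := by
    rw [← integral_Ici_eq_integral_Ioi, integral_Ici_cexp_neg hz0]
    simp
  have hcomp := integrableOn_compensatedCount_mul_exp hz hsum
  have hkey : ∀ s : ℝ,
      ((pointCount q (Set.Ioc (Real.exp θ) (Real.exp θ * Real.exp s))).toReal : ℂ) *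
        Complex.exp (-(z * s)) =
      (compensatedCount q (Real.exp θ) s : ℂ) * Complex.exp (-(z * s)) +
        Complex.exp θ * (Complex.exp (-((z - 1) * s)) - Complex.exp (-(z * s))) := by
    intro s
    have : Complex.exp (-((z - 1) * s)) = Complex.exp s * Complex.exp (-(z * s)) := by
      rw [← Complex.exp_add]; congr 1; ring
    rw [this, compensatedCount]
    push_cast
    ring
  have h := integral_pointCount_mul_exp hz hsum
  simp_rw [hkey] at h
  rw [integral_add (g := fun s : ℝ => Complex.exp θ *
      (Complex.exp (-((z - 1) * s)) - Complex.exp (-(z * s)))) hcomp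
      ((i1.sub i2).const_mul _), integral_const_mul, integral_sub i1 i2,
    v1, v2] at h
  have e1 : Complex.exp ((1 - z) * θ) = Complex.exp θ * Complex.exp (-(z * θ)) := by
    rw [← Complex.exp_add]; congr 1; ring
  have e2 : Complex.exp (-(z * θ)) * Complex.exp (z * θ) = 1 := by
    rw [← Complex.exp_add, neg_add_cancel, Complex.exp_zero]
  set C := ∫ s in Set.Ioi (0 : ℝ),
          (compensatedCount q (Real.exp θ) s : ℂ) * Complex.exp (-(z * s))
  set W := ∑' j, (Set.Ioi (Real.exp θ)).indicator
    (fun t => Complex.exp (-(z * Real.log t))) (q j)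
  -- The compensator e^θ(e^s - 1) has transform e^θ(1/(z-1) - 1/z); multiplied by z e^{-zθ} it
  -- becomes the explicit pole term e^{(1-z)θ}/(z-1).
  have h' : C = Complex.exp (z * θ) / z * W - Complex.exp θ * (1 / (z - 1) - 1 / z) := by
    rw [← h]; ring
  rw [h', e1]
  have : z * Complex.exp (-(z * θ)) * (Complex.exp (z * θ) / z * W) = W := by
    calc _ = (Complex.exp (-(z * θ)) * Complex.exp (z * θ)) * (z * z⁻¹) * W := by ring
      _ = W := by rw [e2, mul_inv_cancel₀ hzne]; ring
  rw [mul_sub, this]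
  field_simp
  ring

end

/-! ### Cutoff exponents and the regions they reach -/

section

variable {m : ℕ}

/-- The logarithm of the cutoff. -/
def cutLog (a l : Fin m → ℝ) : ℝ := -∑ k, a k * l k

lemma rexpNeg_eq_exp_cutLog (a l : Fin m → ℝ) : rexpNeg a l = Real.exp (cutLog a l) := rfl

lemma rexpNeg_affExp (a : Fin m → ℝ) (c : ℝ) (x : Fin (m + 1) → ℝ) (l : Fin m → ℝ) :
    rexpNeg (affExp c a x) l = rexpNeg (fun k => x k.castSucc) l *
      Real.exp ((c - x (Fin.last m)) * cutLog a l) := by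
  rw [← rexpNeg_mul_exp_affExp, rexpNeg_eq_exp_cutLog a l, Real.log_exp]

lemma cexpNeg_affExp (a : Fin m → ℝ) (c : ℂ) (z : Fin (m + 1) → ℂ) (l : Fin m → ℝ) :
    cexpNeg (affExp c (fun k => (a k : ℂ)) z) l = cexpNeg (fun k => z k.castSucc) l *
      Complex.exp ((c - z (Fin.last m)) * cutLog a l) := by
  rw [cexpNeg, cexpNeg, cutLog, ← Complex.exp_add]
  congr 1
  push_cast
  simp only [affExp, add_mul, Finset.sum_add_distrib, mul_neg, Finset.mul_sum, neg_add]
  congr 2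
  exact Finset.sum_congr rfl fun k _ => by ring

lemma rexpNeg_neg_half (a l : Fin m → ℝ) :
    rexpNeg (fun k => -(a k / 2)) l = Real.exp (-(1 / 2 * cutLog a l)) := by
  rw [rexpNeg, cutLog, mul_neg, Finset.mul_sum]
  congr 2
  rw [← Finset.sum_neg_distrib]
  exact Finset.sum_congr rfl fun k _ => by ring

lemma cexpNeg_half_mul_logVec (a : Fin m → ℝ) (z : Fin (m + 1) → ℂ) (p : (Fin m → ℝ) × ℝ) :
    (rexpNeg (fun k => a k / 2) p.1 : ℂ) * cexpNeg z (logVec a p) =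
      cexpNeg (affExp (1 / 2) (fun k => (a k : ℂ)) z) p.1 *
        Complex.exp (-(z (Fin.last m) * p.2)) := by
  rw [rexpNeg, cexpNeg, cexpNeg, Complex.ofReal_exp, ← Complex.exp_add, ← Complex.exp_add,
    Fin.sum_univ_castSucc]
  congr 1
  push_cast
  simp only [logVec, Fin.snoc_castSucc, Fin.snoc_last, affExp]
  push_cast
  simp only [mul_sub, Finset.mul_sum]
  have h : ∑ k, (a k : ℂ) / 2 * p.1 k + ∑ k : Fin m, z k.castSucc * p.1 k -
      ∑ k, z (Fin.last m) * (a k * p.1 k) =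
      ∑ k, (z k.castSucc + (a k * (1 / 2) - a k * z (Fin.last m))) * p.1 k := by
    rw [← Finset.sum_add_distrib, ← Finset.sum_sub_distrib]
    exact Finset.sum_congr rfl fun k _ => by ring
  linear_combination -h

/-- The exponents of the cutoffs. -/
def slope (m n : ℕ) : Fin m → ℝ := fun k => 1 + (m - k) / (n + 1)

/-- Strict decrease and entries above 1 make the cutoffs summable; the limit (1, …, 1) itself is on
the boundary, which is why a sequence of cutoffs is needed. -/
lemma slope_mem (m n : ℕ) : slope m n ∈ realDomain m 1 := by
  refine ⟨fun i j hij => ?_, fun i => ?_⟩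
  · have : ((i : ℕ) : ℝ) < (j : ℕ) := by exact_mod_cast hij
    unfold slope
    gcongr
  · have : ((i : ℕ) : ℝ) < m := by exact_mod_cast i.2
    have h : 0 < ((m : ℝ) - (i : ℕ)) / (n + 1) := div_pos (by linarith) (by positivity)
    unfold slope
    linarith

/-- The (real) region in which the construction with cutoff exponents `a` works. -/
def region (a : Fin m → ℝ) : Set (Fin (m + 1) → ℝ) :=
  {x | 1 / 2 < x (Fin.last m) ∧ affExp 1 a x ∈ realDomain m 1 ∧
    (fun k => 2 * affExp (1 / 2) a x k) ∈ realDomain m 1}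

lemma isOpen_region (a : Fin m → ℝ) : IsOpen (region a) := by
  have h1 : Continuous (affExp (1 : ℝ) a) := by unfold affExp; fun_prop
  have h2 : Continuous (fun x k => 2 * affExp (1 / 2 : ℝ) a x k) := by unfold affExp; fun_prop
  exact (isOpen_lt continuous_const (continuous_apply (Fin.last m))).inter
    (((isOpen_realDomain m 1).preimage h1).inter ((isOpen_realDomain m 1).preimage h2))

lemma affExp_convex_comb (c : ℝ) (a : Fin m → ℝ) (x y : Fin (m + 1) → ℝ) {s t : ℝ}
    (hst : s + t = 1) : affExp c a (s • x + t • y) = s • affExp c a x + t • affExp c a y := by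
  ext k
  obtain rfl : t = 1 - s := by linarith
  simp [affExp]
  ring

/-- Convexity makes intersections of regions connected, as the identity theorem requires. -/
lemma convex_region (a : Fin m → ℝ) : Convex ℝ (region a) := by
  intro x hx y hy s t hs ht hst
  refine ⟨?_, ?_, ?_⟩
  · have h1 := convex_Ioi (1 / 2 : ℝ) hx.1 hy.1 hs ht hst
    simpa using h1
  · rw [affExp_convex_comb _ _ _ _ hst]
    exact convex_realDomain m 1 hx.2.1 hy.2.1 hs ht hst
  · convert convex_realDomain m 1 hx.2.2 hy.2.2 hs ht hst using 1
    rw [affExp_convex_comb _ _ _ _ hst]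
    ext k
    simp
    ring

/-- At the limiting slope 1 the two conditions read z_k - z_d + 1 and 2(z_k - z_d) + 1 in the
m-level domain, which follow from strict monotonicity. Both are open conditions, so they persist for
large `n`. -/
lemma exists_mem_region {x : Fin (m + 1) → ℝ} (hx : x ∈ realDomain (m + 1) (1 / 2)) :
    ∃ n, x ∈ region (slope m n) := by
  have hlim : Tendsto (fun n : ℕ => slope m n) atTop (𝓝 fun _ => 1) := by
    refine tendsto_pi_nhds.2 fun k => ?_
    have h := (tendsto_one_div_add_atTop_nhds_zero_nat (𝕜 := ℝ)).const_mul ((m : ℝ) - (k : ℕ))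
    have h2 := h.const_add 1
    simp only [mul_zero, add_zero] at h2
    refine h2.congr fun n => ?_
    unfold slope
    ring
  have h1 : Continuous fun a : Fin m → ℝ => affExp 1 a x := by unfold affExp; fun_prop
  have h2 : Continuous fun a : Fin m → ℝ => fun k => 2 * affExp (1 / 2) a x k := by
    unfold affExp; fun_prop
  have m1 : affExp 1 (fun _ : Fin m => 1) x ∈ realDomain m 1 := by
    refine ⟨fun i j hij => ?_, fun i => ?_⟩
    · have := hx.1 i.castSucc j.castSucc (by simpa using hij)
      simp only [affExp]; linarith
    · have := hx.1 i.castSucc (Fin.last m) (Fin.castSucc_lt_last i)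
      simp only [affExp]; linarith
  have m2 : (fun k => 2 * affExp (1 / 2) (fun _ : Fin m => 1) x k) ∈ realDomain m 1 := by
    refine ⟨fun i j hij => ?_, fun i => ?_⟩
    · have := hx.1 i.castSucc j.castSucc (by simpa using hij)
      simp only [affExp]; linarith
    · have := hx.1 i.castSucc (Fin.last m) (Fin.castSucc_lt_last i)
      simp only [affExp]; linarith
  have e1 : ∀ᶠ n in atTop, affExp 1 (slope m n) x ∈ realDomain m 1 :=
    ((h1.tendsto _).comp hlim).eventually_mem ((isOpen_realDomain m 1).mem_nhds m1)
  have e2 : ∀ᶠ n in atTop, (fun k => 2 * affExp (1 / 2) (slope m n) x k) ∈ realDomain m 1 :=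
    ((h2.tendsto _).comp hlim).eventually_mem ((isOpen_realDomain m 1).mem_nhds m2)
  obtain ⟨n, hn⟩ := (e1.and e2).exists
  exact ⟨n, hx.2 _, hn.1, hn.2⟩

/-- A common point of all the regions. -/
lemma exists_common_mem (m : ℕ) :
    ∃ x ∈ realDomain (m + 1) 1, ∀ n, x ∈ region (slope m n) := by
  -- The factor 10 gives gaps that dominate the shifts a_k(c - 2) for all slopes, whose entries are
  -- at most 1 + (m - k).
  refine ⟨Fin.snoc (fun k : Fin m => 10 * ((m : ℝ) - (k : ℕ))) 2, ⟨?_, ?_⟩, fun n => ⟨?_, ?_, ?_⟩⟩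
  · intro i j
    refine Fin.lastCases (fun h => absurd h (not_lt.2 (Fin.le_last _))) (fun i h => ?_) i
    induction j using Fin.lastCases with
    | last =>
      have : ((i : ℕ) : ℝ) + 1 ≤ m := by exact_mod_cast i.2
      simp only [Fin.snoc_castSucc, Fin.snoc_last]
      linarith
    | cast j =>
      have : ((i : ℕ) : ℝ) < (j : ℕ) := by exact_mod_cast h
      simp only [Fin.snoc_castSucc]
      linarith
  · intro i
    induction i using Fin.lastCases with
    | last => simp
    | cast i =>
      have : ((i : ℕ) : ℝ) + 1 ≤ m := by exact_mod_cast i.2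
      simp only [Fin.snoc_castSucc]
      linarith
  · simp; norm_num
  all_goals
    have e1 : (0 : ℝ) < 1 / (n + 1) := by positivity
    have e2 : (1 : ℝ) / (n + 1) ≤ 1 := by
      rw [div_le_one (by positivity)]
      have : (0 : ℝ) ≤ n := by positivity
      linarith
    have hs : ∀ k, slope m n k = 1 + ((m : ℝ) - (k : ℕ)) * (1 / (n + 1)) := fun k => by
      unfold slope; ring
    generalize (1 : ℝ) / (n + 1) = ε at e1 e2 hs
    refine ⟨fun i j hij => ?_, fun i => ?_⟩
    · have hij' : ((i : ℕ) : ℝ) < (j : ℕ) := by exact_mod_cast hij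
      simp only [affExp, Fin.snoc_castSucc, Fin.snoc_last, hs]
      nlinarith
    · have hi : ((i : ℕ) : ℝ) + 1 ≤ m := by exact_mod_cast i.2
      simp only [affExp, Fin.snoc_castSucc, Fin.snoc_last, hs]
      nlinarith

end

/-! ### Good realisations of one level -/

section

variable {I : Type*} {m : ℕ}

/-- The logarithms of the coordinates after one more level. -/
def extLog (l : I → Fin m → ℝ) (q : I → ℕ → ℝ) (p : I × ℕ) : Fin (m + 1) → ℝ :=
  Fin.snoc (l p.1) (Real.log (q p.1 p.2))

lemma rexpNeg_extLog (l : I → Fin m → ℝ) (q : I → ℕ → ℝ) (x : Fin (m + 1) → ℝ) (p : I × ℕ) :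
    rexpNeg x (extLog l q p) = rexpNeg (fun k => x k.castSucc) (l p.1) *
      Real.exp (-(x (Fin.last m) * Real.log (q p.1 p.2))) := by
  rw [rexpNeg, rexpNeg, ← Real.exp_add, Fin.sum_univ_castSucc]
  simp only [extLog, Fin.snoc_castSucc, Fin.snoc_last]
  congr 1
  ring

lemma cexpNeg_extLog (l : I → Fin m → ℝ) (q : I → ℕ → ℝ) (z : Fin (m + 1) → ℂ) (p : I × ℕ) :
    cexpNeg z (extLog l q p) = cexpNeg (fun k => z k.castSucc) (l p.1) *
      Complex.exp (-(z (Fin.last m) * Real.log (q p.1 p.2))) := by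
  rw [cexpNeg, cexpNeg, ← Complex.exp_add, Fin.sum_univ_castSucc]
  simp only [extLog, Fin.snoc_castSucc, Fin.snoc_last]
  congr 1
  ring

/-- The properties of a realisation of the points at one level of the cascade that suffice for the
convergence and the continuation of the zeta function. -/
structure IsGoodLevel (l : I → Fin m → ℝ) (q : I → ℕ → ℝ) : Prop where
  finiteExpSums : FiniteExpSums l
  pos : ∀ i j, 0 < q i j
  low : ∀ n, lowCount (slope m n) l q ≠ ∞
  high : ∀ n (x : Fin (m + 1) → ℚ), 1 < ratVec x (Fin.last m) →
    affExp 1 (slope m n) (ratVec x) ∈ realDomain m 1 →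
    highSum (slope m n) (ratVec x) l q ≠ ∞
  abs : ∀ n (x : Fin (m + 1) → ℚ), ratVec x ∈ region (slope m n) →
    absIntegral (slope m n) (ratVec x) l q ≠ ∞

/-- The pairs `(i, j)` for which the point `q i j` is not above the cutoff. -/
def lowSet (a : Fin m → ℝ) (l : I → Fin m → ℝ) (q : I → ℕ → ℝ) : Set (I × ℕ) :=
  {p | q p.1 p.2 ≤ rexpNeg a (l p.1)}

variable {l : I → Fin m → ℝ} {q : I → ℕ → ℝ}

lemma mem_lowSet {a : Fin m → ℝ} {p : I × ℕ} :
    p ∈ lowSet a l q ↔ q p.1 p.2 ≤ rexpNeg a (l p.1) := Iff.rfl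

/-- Every pair in the set contributes 1 to the finite sum `lowCount`. -/
lemma IsGoodLevel.finite_lowSet (h : IsGoodLevel l q) (n : ℕ) :
    (lowSet (slope m n) l q).Finite := by
  have h1 := h.low n
  unfold lowCount pointCount at h1
  rw [← ENNReal.tsum_prod (f := fun i j =>
    (Set.Ioc 0 (rexpNeg (slope m n) (l i))).indicator (1 : ℝ → ℝ≥0∞) (q i j))] at h1
  refine (ENNReal.finite_const_le_of_tsum_ne_top h1 one_ne_zero).subset fun p hp => ?_
  have hp' : q p.1 p.2 ∈ Set.Ioc 0 (rexpNeg (slope m n) (l p.1)) := ⟨h.pos _ _, mem_lowSet.1 hp⟩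
  simp [hp']

/-- The array of logarithms after one more level has finite exponential sums. -/
lemma IsGoodLevel.finiteExpSums_extLog [Countable I] (h : IsGoodLevel l q) :
    FiniteExpSums (extLog l q) := by
  let _ : MeasurableSpace (I × ℕ) := ⊤
  intro x hx
  have key := lintegral_rexpNeg_ne_top (ν := Measure.count) (h := fun _ : I × ℕ => 1)
    aemeasurable_const (l := extLog l q) measurable_from_top (isOpen_realDomain (m + 1) 1) ?_ hx
  · simpa [lintegral_count] using key
  intro x hx
  -- For a cutoff adapted to `x`, the finitely many low points contribute finitely much and the
  -- others form `highSum`.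
  obtain ⟨n, hn⟩ := exists_mem_region (x := ratVec x) ⟨hx.1, fun i => by linarith [hx.2 i]⟩
  simp only [one_mul, lintegral_count]
  have hfin := h.finite_lowSet n
  have hhigh := h.high n x (hx.2 _) hn.2.1
  unfold highSum at hhigh
  rw [← ENNReal.tsum_prod (f := fun i j =>
    ENNReal.ofReal (rexpNeg (fun k => ratVec x k.castSucc) (l i)) *
    (Set.Ioi (rexpNeg (slope m n) (l i))).indicator
      (fun t => ENNReal.ofReal (Real.exp (-(ratVec x (Fin.last m) * Real.log t)))) (q i j))]
    at hhigh
  set f : I × ℕ → ℝ≥0∞ := fun p => ENNReal.ofReal (rexpNeg (ratVec x) (extLog l q p)) with hf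
  have hle : ∀ p, f p ≤ (lowSet (slope m n) l q).indicator f p +
      ENNReal.ofReal (rexpNeg (fun k => ratVec x k.castSucc) (l p.1)) *
        (Set.Ioi (rexpNeg (slope m n) (l p.1))).indicator
          (fun t => ENNReal.ofReal (Real.exp (-(ratVec x (Fin.last m) * Real.log t))))
          (q p.1 p.2) := by
    intro p
    by_cases hp : p ∈ lowSet (slope m n) l q
    · rw [Set.indicator_of_mem hp]
      exact le_self_add
    · rw [Set.indicator_of_notMem hp, zero_add,
        Set.indicator_of_mem (Set.mem_Ioi.2 (not_le.1 (mt mem_lowSet.2 hp))),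
        ← ENNReal.ofReal_mul (rexpNeg_pos _ _).le, ← rexpNeg_extLog]
  refine ne_top_of_le_ne_top ?_ (ENNReal.tsum_le_tsum hle)
  rw [ENNReal.tsum_add]
  refine ENNReal.add_ne_top.2 ⟨?_, hhigh⟩
  rw [tsum_eq_sum (s := hfin.toFinset) fun p hp => Set.indicator_of_notMem (by simpa using hp) _]
  refine ENNReal.sum_ne_top.2 fun p hp => ?_
  rw [Set.indicator_of_mem (by simpa using hp)]
  exact ENNReal.ofReal_ne_top

end

/-! ### The series on its domain of absolute convergence -/

section

variable {I : Type*} {d : ℕ} {l : I → Fin d → ℝ}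

lemma FiniteExpSums.summable_norm (h : FiniteExpSums l) {z : Fin d → ℂ} (hz : z ∈ domain d 1) :
    Summable fun i => ‖cexpNeg z (l i)‖ := by
  simp_rw [norm_cexpNeg]
  have h1 := ENNReal.summable_toReal (h (reVec z) hz)
  exact h1.congr fun i => ENNReal.toReal_ofReal (rexpNeg_pos _ _).le

/-- Provides the summable majorant, uniform on a ball of radius `r`, for Weierstrass' test. -/
lemma FiniteExpSums.exists_bound [Countable I] (h : FiniteExpSums l) {z : Fin d → ℂ}
    (hz : z ∈ domain d 1) :
    ∃ r > 0, Summable fun i => rexpNeg (reVec z) (l i) * Real.exp (r * ∑ k, |l i k|) := by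
  let _ : MeasurableSpace I := ⊤
  obtain ⟨r, hr, h1⟩ := lintegral_rexpNeg_mul_exp_ne_top (ν := Measure.count)
    (h := fun _ : I => 1) aemeasurable_const (l := l) measurable_from_top (isOpen_realDomain d 1)
    (fun q hq => by simpa [lintegral_count] using h _ hq) hz
  refine ⟨r, hr, ?_⟩
  simp only [one_mul, lintegral_count] at h1
  have h2 := ENNReal.summable_toReal h1
  exact h2.congr fun i => ENNReal.toReal_ofReal (mul_pos (rexpNeg_pos _ _) (Real.exp_pos _)).le

lemma norm_cexpNeg_le {z w : Fin d → ℂ} {r : ℝ} (hzw : ‖w - z‖ ≤ r) (x : Fin d → ℝ) :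
    ‖cexpNeg w x‖ ≤ rexpNeg (reVec z) x * Real.exp (r * ∑ k, |x k|) := by
  rw [norm_cexpNeg, rexpNeg, rexpNeg, ← Real.exp_add]
  refine Real.exp_le_exp.2 ?_
  rw [Finset.mul_sum, ← Finset.sum_neg_distrib, ← Finset.sum_neg_distrib,
    ← Finset.sum_add_distrib]
  refine Finset.sum_le_sum fun k _ => ?_
  have h1 : |(w k).re - (z k).re| ≤ r := by
    refine le_trans ?_ ((norm_le_pi_norm (w - z) k).trans hzw)
    rw [← Complex.sub_re]
    exact Complex.abs_re_le_norm _
  have h2 : -(((w k).re - (z k).re) * x k) ≤ |(w k).re - (z k).re| * |x k| := by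
    rw [← abs_mul]; exact neg_le_abs _
  have h3 := mul_le_mul_of_nonneg_right h1 (abs_nonneg (x k))
  simp only [reVec]
  linarith [sub_mul (w k).re (z k).re (x k)]

/-- Weierstrass' test on compact sets. -/
lemma FiniteExpSums.tendstoUniformlyOn [Countable I] (h : FiniteExpSums l) {K : Set (Fin d → ℂ)}
    (hK : IsCompact K) (hKD : K ⊆ domain d 1) {E : Type*} [NormedAddCommGroup E] [CompleteSpace E]
    {f : I → (Fin d → ℂ) → E} (hf : ∀ i z, ‖f i z‖ = ‖cexpNeg z (l i)‖) :
    TendstoUniformlyOn (fun (s : Finset I) z => ∑ i ∈ s, f i z) (fun z => ∑' i, f i z) atTop K := by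
  rw [← tendstoLocallyUniformlyOn_iff_tendstoUniformlyOn_of_compact hK]
  refine tendstoLocallyUniformlyOn_of_forall_exists_nhds fun z hz => ?_
  obtain ⟨r, hr, hs⟩ := h.exists_bound (hKD hz)
  refine ⟨Metric.closedBall z r, mem_nhdsWithin_of_mem_nhds (Metric.closedBall_mem_nhds z hr), ?_⟩
  refine tendstoUniformlyOn_tsum hs fun i w hw => ?_
  rw [hf]
  exact norm_cexpNeg_le (by simpa [dist_eq_norm] using hw) _

/-- The series is a Laplace transform with respect to counting measure. -/
lemma FiniteExpSums.analyticOnNhd [Countable I] (h : FiniteExpSums l) :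
    AnalyticOnNhd ℂ (fun z => ∑' i, cexpNeg z (l i)) (domain d 1) := by
  let _ : MeasurableSpace I := ⊤
  have : DiscreteMeasurableSpace I := ⟨fun _ => trivial⟩
  have h1 := analyticOnNhd_integral_cexpNeg (ν := Measure.count) (g := fun _ : I => 1)
    aestronglyMeasurable_const (l := l) measurable_from_top (isOpen_realDomain d 1)
    (fun q hq => by simpa [lintegral_count] using h _ hq)
  refine h1.congr ((isOpen_realDomain d 1).preimage continuous_reVec) fun z hz => ?_
  rw [integral_countable]
  · simp
  · refine ⟨Measurable.aestronglyMeasurable measurable_from_top, ?_⟩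
    rw [hasFiniteIntegral_iff_enorm]
    refine lt_top_iff_ne_top.2 ?_
    have h2 := h (reVec z) hz
    convert h2 using 1
    rw [lintegral_count]
    refine tsum_congr fun i => ?_
    rw [one_mul, ← ofReal_norm, norm_cexpNeg]

end

/-! ### The continuation for one choice of cutoffs -/

section

variable {I : Type*} {m : ℕ} {l : I → Fin m → ℝ} {q : I → ℕ → ℝ}

/-- The complex version of `affExp` with real parameters. -/
def caffExp (c : ℂ) (a : Fin m → ℝ) (z : Fin (m + 1) → ℂ) : Fin m → ℂ :=
  affExp c (fun k => (a k : ℂ)) z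

/-- The contribution of the points above the cutoffs, after compensation. -/
def tailIntegral (a : Fin m → ℝ) (l : I → Fin m → ℝ) (q : I → ℕ → ℝ) (z : Fin (m + 1) → ℂ) : ℂ :=
  ∫ p, (density a l q p : ℂ) * cexpNeg z (logVec a p) ∂(halfSpaceMeasure m)

/-- The contribution of the points which are not above the cutoffs. -/
def lowSum (a : Fin m → ℝ) (l : I → Fin m → ℝ) (q : I → ℕ → ℝ) (z : Fin (m + 1) → ℂ) : ℂ :=
  ∑' p, (lowSet a l q).indicator (fun p => cexpNeg z (extLog l q p)) p

/-- The continuation of `(z_d - 1) ζ(z)` constructed with the cutoff exponents `a`. -/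
def continuation (a : Fin m → ℝ) (l : I → Fin m → ℝ) (q : I → ℕ → ℝ) (z : Fin (m + 1) → ℂ) : ℂ :=
  (z (Fin.last m) - 1) * lowSum a l q z + ∑' i, cexpNeg (caffExp 1 a z) (l i) +
    (z (Fin.last m) - 1) * z (Fin.last m) * (∏ k, caffExp (1 / 2) a z k) * tailIntegral a l q z

lemma analyticAt_coord {d : ℕ} (k : Fin d) (z : Fin d → ℂ) :
    AnalyticAt ℂ (fun z : Fin d → ℂ => z k) z :=
  (ContinuousLinearMap.proj (R := ℂ) (φ := fun _ : Fin d => ℂ) k).analyticAt z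

lemma analyticAt_caffExp (c : ℂ) (a : Fin m → ℝ) (k : Fin m) (z : Fin (m + 1) → ℂ) :
    AnalyticAt ℂ (fun z => caffExp c a z k) z :=
  (analyticAt_coord _ z).add
    (analyticAt_const.mul (analyticAt_const.sub (analyticAt_coord _ z)))

lemma analyticAt_cexpNeg {d : ℕ} (x : Fin d → ℝ) (z : Fin d → ℂ) :
    AnalyticAt ℂ (fun z => cexpNeg z x) z := by
  unfold cexpNeg
  refine AnalyticAt.cexp (AnalyticAt.neg ?_)
  exact Finset.analyticAt_fun_sum _ fun k _ => (analyticAt_coord k z).mul analyticAt_const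

lemma IsGoodLevel.analyticAt_lowSum (h : IsGoodLevel l q) (n : ℕ) (z : Fin (m + 1) → ℂ) :
    AnalyticAt ℂ (lowSum (slope m n) l q) z := by
  have hfin := h.finite_lowSet n
  have : lowSum (slope m n) l q = fun z => ∑ p ∈ hfin.toFinset, cexpNeg z (extLog l q p) := by
    ext z
    unfold lowSum
    rw [tsum_eq_sum (s := hfin.toFinset) fun p hp => Set.indicator_of_notMem (by simpa using hp) _]
    exact Finset.sum_congr rfl fun p hp => Set.indicator_of_mem (by simpa using hp) _
  rw [this]
  exact Finset.analyticAt_fun_sum _ fun p _ => analyticAt_cexpNeg _ z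

/-- The conditions of `region` are used separately: the `affExp 1` condition makes the main series
analytic, while the whole region controls the tail integral through `absIntegral`. -/
lemma IsGoodLevel.analyticOnNhd_continuation [Countable I] (h : IsGoodLevel l q) (n : ℕ) :
    AnalyticOnNhd ℂ (continuation (slope m n) l q) (reVec ⁻¹' region (slope m n)) := by
  intro z hz
  have h1 : AnalyticAt ℂ (fun z => ∑' i, cexpNeg (caffExp 1 (slope m n) z) (l i)) z := by
    have hmem : caffExp 1 (slope m n) z ∈ domain m 1 := by
      show reVec _ ∈ realDomain m 1
      have := reVec_affExp 1 (slope m n) z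
      rw [Complex.ofReal_one] at this
      rw [caffExp, this]
      exact hz.2.1
    have h2 : AnalyticAt ℂ (caffExp 1 (slope m n)) z :=
      analyticAt_pi_iff.2 fun k => analyticAt_caffExp 1 _ k z
    exact (h.finiteExpSums.analyticOnNhd _ hmem).comp h2
  have h3 : AnalyticAt ℂ (tailIntegral (slope m n) l q) z := by
    refine analyticOnNhd_integral_cexpNeg (g := fun p => (density (slope m n) l q p : ℂ)) ?_
      (measurable_logVec _) (isOpen_region (slope m n)) (fun x hx => ?_) z hz
    · have : Measurable (density (slope m n) l q) :=
        measurable_density _ measurable_const measurable_const measurable_id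
      exact (Complex.measurable_ofReal.comp this).aestronglyMeasurable
    · simp_rw [enorm_ofReal_complex]
      exact h.abs n x hx
  have h4 : AnalyticAt ℂ (fun z => ∏ k, caffExp (1 / 2) (slope m n) z k) z :=
    Finset.analyticAt_fun_prod _ fun k _ => analyticAt_caffExp _ _ k z
  have h5 := analyticAt_coord (Fin.last m) z
  exact (((h5.sub analyticAt_const).mul (h.analyticAt_lowSum n z)).add h1).add
    ((((h5.sub analyticAt_const).mul h5).mul h4).mul h3)

/-- The normalised `i`-th summand of the compensated sum. -/
def compensatedTerm (a : Fin m → ℝ) (l : I → Fin m → ℝ) (q : I → ℕ → ℝ) (z : ℂ) (i : I) : ℂ :=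
  (rexpNeg (fun k => -(a k / 2)) (l i) : ℂ) * ∫ s in Set.Ioi (0 : ℝ),
    (compensatedCount (q i) (Real.exp (cutLog a (l i))) s : ℂ) * Complex.exp (-(z * s))

/-- Smearing exp(-⟨v, x⟩) over the orthant above `x` costs the factor 1/∏ v_k, which `continuation`
compensates by an explicit product. -/
lemma integral_indicator_Ici_cexpNeg {v : Fin m → ℂ} (hv : ∀ k, 0 < (v k).re) (x : Fin m → ℝ) :
    ∫ τ, (Set.Ici x).indicator (fun τ => cexpNeg v τ) τ = cexpNeg v x / ∏ k, v k := by
  have h1 : ∀ τ : Fin m → ℝ, (Set.Ici x).indicator (fun τ => cexpNeg v τ) τ =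
      ∏ k, (Set.Ici (x k)).indicator (fun t : ℝ => Complex.exp (-(v k * t))) (τ k) := by
    intro τ
    rw [← indicator_Ici_pi_eq_prod]
    simp_rw [cexpNeg_eq_prod]
  simp_rw [h1]
  rw [volume_pi, integral_fintype_prod_eq_prod
    (f := fun k => (Set.Ici (x k)).indicator (fun t : ℝ => Complex.exp (-(v k * t)))),
    cexpNeg_eq_prod, ← Finset.prod_div_distrib]
  refine Finset.prod_congr rfl fun k _ => ?_
  rw [integral_indicator measurableSet_Ici, integral_Ici_cexp_neg (hv k)]

lemma lintegral_indicator_Ici_cexpNeg {v : Fin m → ℂ} (hv : ∀ k, 0 < (v k).re) (x : Fin m → ℝ) :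
    ∫⁻ τ, ‖(Set.Ici x).indicator (fun τ => cexpNeg v τ) τ‖ₑ =
      ENNReal.ofReal (rexpNeg (reVec v) x / ∏ k, (v k).re) := by
  have h1 : ∀ τ : Fin m → ℝ, ‖(Set.Ici x).indicator (fun τ => cexpNeg v τ) τ‖ₑ =
      ENNReal.ofReal (∏ k, (Set.Ici (x k)).indicator
        (fun t : ℝ => Real.exp (-((v k).re * t))) (τ k)) := by
    intro τ
    rw [← indicator_Ici_pi_eq_prod x (fun k (t : ℝ) => Real.exp (-((v k).re * t))), ← ofReal_norm,
      norm_indicator_eq_indicator_norm]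
    simp_rw [norm_cexpNeg, rexpNeg_eq_prod, reVec]
  simp_rw [h1]
  rw [lintegral_ofReal_prod (f := fun k => (Set.Ici (x k)).indicator
      (fun t : ℝ => Real.exp (-((v k).re * t))))
    (fun k => (integrable_indicator_iff measurableSet_Ici).2 (integrableOn_Ici_exp_neg (hv k) _))
    (fun k t => Set.indicator_nonneg (fun t _ => (Real.exp_pos _).le) t),
    rexpNeg_eq_prod, ← Finset.prod_div_distrib]
  congr 1
  refine Finset.prod_congr rfl fun k _ => ?_
  rw [integral_indicator measurableSet_Ici, integral_Ici_exp_neg (hv k)]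
  rfl

/-- Discarding the points below the cutoff only decreases the convergent sum over all pairs. -/
lemma sum_pointSum_ne_top (hl : FiniteExpSums (extLog l q)) (a : Fin m → ℝ)
    {x : Fin (m + 1) → ℝ} (hx : x ∈ realDomain (m + 1) 1) :
    ∑' i, ENNReal.ofReal (rexpNeg (fun k => x k.castSucc) (l i)) *
      ∑' j, (Set.Ioi (Real.exp (cutLog a (l i)))).indicator
        (fun t => ENNReal.ofReal (Real.exp (-(x (Fin.last m) * Real.log t)))) (q i j) ≠ ∞ := by
  have h1 := hl x hx
  rw [ENNReal.tsum_prod'] at h1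
  refine ne_top_of_le_ne_top h1 (ENNReal.tsum_le_tsum fun i => ?_)
  rw [← ENNReal.tsum_mul_left]
  refine ENNReal.tsum_le_tsum fun j => ?_
  rw [rexpNeg_extLog, ENNReal.ofReal_mul (rexpNeg_pos _ _).le]
  gcongr
  exact Set.indicator_le_self _ _ _

lemma pointSum_ne_top (hl : FiniteExpSums (extLog l q)) (a : Fin m → ℝ)
    {x : Fin (m + 1) → ℝ} (hx : x ∈ realDomain (m + 1) 1) (i : I) :
    ∑' j, (Set.Ioi (Real.exp (cutLog a (l i)))).indicator
        (fun t => ENNReal.ofReal (Real.exp (-(x (Fin.last m) * Real.log t)))) (q i j) ≠ ∞ := by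
  intro htop
  refine ENNReal.ne_top_of_tsum_ne_top (sum_pointSum_ne_top hl a hx) i ?_
  rw [htop, ENNReal.mul_top]
  simp [rexpNeg_pos]

/-- Termwise integration in the integral representation. -/
lemma prod_mul_tailIntegral [Countable I] (hbase : FiniteExpSums l)
    (hl : FiniteExpSums (extLog l q)) {a : Fin m → ℝ} {z : Fin (m + 1) → ℂ}
    (hz : z ∈ domain (m + 1) 1) (hU : reVec z ∈ region a) :
    (∏ k, caffExp (1 / 2) a z k) * tailIntegral a l q z =
      ∑' i, cexpNeg (caffExp (1 / 2) a z) (l i) * compensatedTerm a l q (z (Fin.last m)) i := by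
  set v := caffExp (1 / 2) a z with hv
  set zd := z (Fin.last m) with hzd
  have hzd1 : 1 < zd.re := hz.2 _
  have hvy : reVec v = affExp (1 / 2) a (reVec z) := by
    have := reVec_affExp (1 / 2) a z
    push_cast at this
    exact this
  have hv0 : ∀ k, 0 < (v k).re := by
    intro k
    have h1 := hU.2.2.2 k
    rw [← hvy] at h1
    simp only [reVec] at h1
    linarith
  have hvne : ∏ k, v k ≠ 0 := Finset.prod_ne_zero_iff.2 fun k _ h0 => by
    have := hv0 k
    rw [h0] at this
    simp at this
  set c : I → ℝ := fun i => rexpNeg (fun k => -(a k / 2)) (l i) with hc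
  set G : I → (Fin m → ℝ) × ℝ → ℂ := fun i p =>
    (Set.Ici (l i)).indicator (fun τ => cexpNeg v τ) p.1 *
      ((c i : ℂ) * ((compensatedCount (q i) (Real.exp (cutLog a (l i))) p.2 : ℂ) *
        Complex.exp (-(zd * p.2)))) with hG
  have hpt : ∀ p, (density a l q p : ℂ) * cexpNeg z (logVec a p) = ∑' i, G i p := by
    intro p
    rw [density, compensatedSum, Complex.ofReal_mul, mul_assoc, cexpNeg_half_mul_logVec,
      Complex.ofReal_tsum, ← tsum_mul_right]
    refine tsum_congr fun i => ?_
    rw [hG]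
    by_cases hp : p.1 ∈ Set.Ici (l i)
    · simp only [Set.indicator_of_mem hp, hc, rexpNeg_eq_exp_cutLog a (l i), hv, caffExp]
      push_cast
      ring
    · simp only [Set.indicator_of_notMem hp]
      simp
  have hm1 : ∀ i, Measurable fun τ => (Set.Ici (l i)).indicator (fun τ => cexpNeg v τ) τ :=
    fun i => (measurable_cexpNeg v measurable_id).indicator measurableSet_Ici
  have hm2 : ∀ i, Measurable fun s : ℝ => (c i : ℂ) *
      ((compensatedCount (q i) (Real.exp (cutLog a (l i))) s : ℂ) * Complex.exp (-(zd * s))) := by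
    intro i
    have h : Measurable fun s => compensatedCount (q i) (Real.exp (cutLog a (l i))) s :=
      measurable_compensatedCount measurable_const measurable_const measurable_id
    fun_prop
  have hGi : ∀ i, ∫ p, G i p ∂(halfSpaceMeasure m) =
      cexpNeg v (l i) / (∏ k, v k) * compensatedTerm a l q zd i := by
    intro i
    rw [hG, halfSpaceMeasure, integral_prod_mul
      (f := fun τ => (Set.Ici (l i)).indicator (fun τ => cexpNeg v τ) τ)
      (g := fun s : ℝ => (c i : ℂ) *
        ((compensatedCount (q i) (Real.exp (cutLog a (l i))) s : ℂ) * Complex.exp (-(zd * s)))),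
      integral_indicator_Ici_cexpNeg hv0, integral_const_mul, compensatedTerm]
  -- The majorant is a combination of two sequences summable over `i`: the point sums, by
  -- `sum_pointSum_ne_top`, and the m-level terms at `affExp 1 a`, by `hbase`.
  have hGn : ∀ i, ∫⁻ p, ‖G i p‖ₑ ∂(halfSpaceMeasure m) ≤
      ENNReal.ofReal ((∏ k, (v k).re)⁻¹) * (ENNReal.ofReal (1 / zd.re) *
        (ENNReal.ofReal (rexpNeg (fun k => reVec z k.castSucc) (l i)) *
      ∑' j, (Set.Ioi (Real.exp (cutLog a (l i)))).indicator
        (fun t => ENNReal.ofReal (Real.exp (-(reVec z (Fin.last m) * Real.log t)))) (q i j)) +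
        ENNReal.ofReal (1 / (zd.re - 1)) *
          ENNReal.ofReal (rexpNeg (affExp 1 a (reVec z)) (l i))) := by
    intro i
    have e1 : ∀ p, ‖G i p‖ₑ = ‖(Set.Ici (l i)).indicator (fun τ => cexpNeg v τ) p.1‖ₑ *
        ‖(c i : ℂ) * ((compensatedCount (q i) (Real.exp (cutLog a (l i))) p.2 : ℂ) *
          Complex.exp (-(zd * p.2)))‖ₑ := fun p => enorm_mul _ _
    simp_rw [e1]
    rw [halfSpaceMeasure, lintegral_prod_mul
      (f := fun τ => ‖(Set.Ici (l i)).indicator (fun τ => cexpNeg v τ) τ‖ₑ)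
      (g := fun s : ℝ => ‖(c i : ℂ) * ((compensatedCount (q i)
        (Real.exp (cutLog a (l i))) s : ℂ) * Complex.exp (-(zd * s)))‖ₑ)
      (hm1 i).enorm.aemeasurable (hm2 i).enorm.aemeasurable,
      lintegral_indicator_Ici_cexpNeg hv0, div_eq_mul_inv, mul_comm (rexpNeg _ _),
      ENNReal.ofReal_mul (inv_nonneg.2 (Finset.prod_nonneg fun k _ => (hv0 k).le)), mul_assoc]
    gcongr
    have e2 : ∀ s : ℝ, ‖(c i : ℂ) * ((compensatedCount (q i)
        (Real.exp (cutLog a (l i))) s : ℂ) * Complex.exp (-(zd * s)))‖ₑ =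
        ENNReal.ofReal (c i) * (‖compensatedCount (q i) (Real.exp (cutLog a (l i))) s‖ₑ *
          ENNReal.ofReal (Real.exp (-(zd.re * s)))) := by
      intro s
      rw [enorm_mul, enorm_mul, enorm_ofReal_complex, enorm_ofReal_complex, enorm_cexp_neg_mul,
        Real.enorm_of_nonneg (rexpNeg_pos _ _).le]
    simp_rw [e2]
    rw [lintegral_const_mul' _ _ ENNReal.ofReal_ne_top]
    refine (mul_le_mul_right (mul_le_mul_right
      (lintegral_compensatedCount_mul_exp_le hzd1) _) _).trans (le_of_eq ?_)
    have hyc : rexpNeg (reVec v) (l i) * c i = rexpNeg (fun k => reVec z k.castSucc) (l i) *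
        Real.exp (-(zd.re * cutLog a (l i))) := by
      rw [hvy, rexpNeg_affExp, hc]
      simp only [rexpNeg_neg_half]
      rw [mul_assoc, ← Real.exp_add]
      congr 2
      simp only [reVec, hzd]
      ring
    have f1 : Real.exp (-(zd.re * cutLog a (l i))) * Real.exp (zd.re * cutLog a (l i)) = 1 := by
      rw [← Real.exp_add, neg_add_cancel, Real.exp_zero]
    have f2 : Real.exp (-(zd.re * cutLog a (l i))) * Real.exp (cutLog a (l i)) =
        Real.exp ((1 - zd.re) * cutLog a (l i)) := by
      rw [← Real.exp_add]; congr 1; ring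
    have g1 : ENNReal.ofReal (rexpNeg (reVec v) (l i)) * ENNReal.ofReal (c i) *
        ENNReal.ofReal (Real.exp (zd.re * cutLog a (l i)) / zd.re) =
        ENNReal.ofReal (1 / zd.re) *
          ENNReal.ofReal (rexpNeg (fun k => reVec z k.castSucc) (l i)) := by
      rw [← ENNReal.ofReal_mul (rexpNeg_pos _ _).le, hyc,
        ← ENNReal.ofReal_mul (mul_pos (rexpNeg_pos _ _) (Real.exp_pos _)).le,
        ← ENNReal.ofReal_mul (one_div_nonneg.2 (by linarith)), mul_div_assoc', mul_assoc, f1]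
      congr 1
      ring
    have g2 : ENNReal.ofReal (rexpNeg (reVec v) (l i)) * ENNReal.ofReal (c i) *
        ENNReal.ofReal (Real.exp (cutLog a (l i)) / (zd.re - 1)) =
        ENNReal.ofReal (1 / (zd.re - 1)) *
          ENNReal.ofReal (rexpNeg (affExp 1 a (reVec z)) (l i)) := by
      rw [← ENNReal.ofReal_mul (rexpNeg_pos _ _).le, hyc,
        ← ENNReal.ofReal_mul (mul_pos (rexpNeg_pos _ _) (Real.exp_pos _)).le,
        ← ENNReal.ofReal_mul (one_div_nonneg.2 (by linarith)), mul_div_assoc', mul_assoc, f2,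
        rexpNeg_affExp]
      congr 1
      simp only [reVec, hzd]
      ring
    rw [← mul_assoc, mul_add, ← mul_assoc, g1, g2, mul_assoc]
    rfl
  unfold tailIntegral
  simp_rw [hpt]
  rw [integral_tsum]
  · simp_rw [hGi]
    rw [← tsum_mul_left]
    refine tsum_congr fun i => ?_
    field_simp
  · exact fun i => (((hm1 i).comp measurable_fst).mul
      ((hm2 i).comp measurable_snd)).aestronglyMeasurable
  · refine ne_top_of_le_ne_top ?_ (ENNReal.tsum_le_tsum hGn)
    rw [ENNReal.tsum_mul_left, ENNReal.tsum_add, ENNReal.tsum_mul_left, ENNReal.tsum_mul_left]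
    refine ENNReal.mul_ne_top ENNReal.ofReal_ne_top (ENNReal.add_ne_top.2 ⟨?_, ?_⟩)
    · exact ENNReal.mul_ne_top ENNReal.ofReal_ne_top (sum_pointSum_ne_top hl a hz)
    · exact ENNReal.mul_ne_top ENNReal.ofReal_ne_top (hbase _ hU.2.1)

/-- On the domain of convergence the continuation agrees with the series. -/
theorem IsGoodLevel.continuation_eq [Countable I] (h : IsGoodLevel l q) {a : Fin m → ℝ}
    {z : Fin (m + 1) → ℂ} (hz : z ∈ domain (m + 1) 1) (hU : reVec z ∈ region a) :
    continuation a l q z = (z (Fin.last m) - 1) * ∑' p, cexpNeg z (extLog l q p) := by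
  have hl := h.finiteExpSums_extLog
  set zd := z (Fin.last m) with hzd
  have hzd1 : 1 < zd.re := hz.2 _
  have hne : zd - 1 ≠ 0 := fun h0 => by
    rw [sub_eq_zero] at h0
    simp [h0] at hzd1
  have hs : Summable fun p => cexpNeg z (extLog l q p) := (hl.summable_norm hz).of_norm
  have hsplit : ∑' p, cexpNeg z (extLog l q p) = lowSum a l q z +
      ∑' p, (lowSet a l q)ᶜ.indicator (fun p => cexpNeg z (extLog l q p)) p := by
    rw [lowSum, ← (hs.indicator _).tsum_add (hs.indicator _)]
    exact tsum_congr fun p => (Set.indicator_self_add_compl_apply (lowSet a l q)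
      (fun p => cexpNeg z (extLog l q p)) p).symm
  -- For each `i`, summation by parts splits the points above the cutoff into the pole term and the
  -- compensated term.
  have hin : ∀ i, ∑' j, (lowSet a l q)ᶜ.indicator (fun p => cexpNeg z (extLog l q p)) (i, j) =
      cexpNeg (caffExp 1 a z) (l i) * (zd - 1)⁻¹ +
        zd * (cexpNeg (caffExp (1 / 2) a z) (l i) * compensatedTerm a l q zd i) := by
    intro i
    have e1 : ∀ j, (lowSet a l q)ᶜ.indicator (fun p => cexpNeg z (extLog l q p)) (i, j) =
        cexpNeg (fun k => z k.castSucc) (l i) * (Set.Ioi (Real.exp (cutLog a (l i)))).indicator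
          (fun t => Complex.exp (-(zd * Real.log t))) (q i j) := by
      intro j
      by_cases hp : (i, j) ∈ lowSet a l q
      · rw [Set.indicator_of_notMem (by simpa using hp),
          Set.indicator_of_notMem (show q i j ∉ Set.Ioi (Real.exp (cutLog a (l i))) from
            not_lt.2 (mem_lowSet.1 hp)), mul_zero]
      · rw [Set.indicator_of_mem (by simpa using hp),
          Set.indicator_of_mem (show q i j ∈ Set.Ioi (Real.exp (cutLog a (l i))) from
            not_le.1 (mt mem_lowSet.2 hp)), cexpNeg_extLog]
    simp_rw [e1]
    rw [tsum_mul_left, tsum_indicator_cexp_eq hzd1 (pointSum_ne_top hl a hz i), compensatedTerm,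
      caffExp, caffExp, cexpNeg_affExp, cexpNeg_affExp, rexpNeg_neg_half, ← hzd]
    have e2 : Complex.exp ((1 / 2 - zd) * cutLog a (l i)) *
        ((Real.exp (-(1 / 2 * cutLog a (l i))) : ℝ) : ℂ) =
        Complex.exp (-(zd * cutLog a (l i))) := by
      rw [Complex.ofReal_exp, ← Complex.exp_add]
      congr 1
      push_cast
      ring
    rw [← e2]
    ring
  have hs2 := hs.indicator (lowSet a l q)ᶜ
  have hs3 := hs2.prod
  simp_rw [hin] at hs3
  have hmem : caffExp 1 a z ∈ domain m 1 := by
    show reVec _ ∈ realDomain m 1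
    have := reVec_affExp 1 a z
    rw [Complex.ofReal_one] at this
    rw [caffExp, this]
    exact hU.2.1
  have hs4 : Summable fun i => cexpNeg (caffExp 1 a z) (l i) :=
    (h.finiteExpSums.summable_norm hmem).of_norm
  have hs5 := hs4.mul_right ((zd - 1)⁻¹)
  -- Obtained by difference: the sums over `j` and the pole terms are both summable in `i`.
  have hs6 : Summable fun i =>
      zd * (cexpNeg (caffExp (1 / 2) a z) (l i) * compensatedTerm a l q zd i) := by
    refine (hs3.sub hs5).congr fun i => ?_
    ring
  rw [hsplit, hs2.tsum_prod]
  simp_rw [hin]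
  rw [hs5.tsum_add hs6, tsum_mul_left, tsum_mul_right,
    ← prod_mul_tailIntegral h.finiteExpSums hl hz hU, continuation, ← hzd]
  field_simp
  ring

end

/-! ### Gluing the continuations -/

lemma isOpen_domain (d : ℕ) (c : ℝ) : IsOpen (domain d c) :=
  (isOpen_realDomain d c).preimage continuous_reVec

lemma isLinearMap_reVec (d : ℕ) : IsLinearMap ℝ (reVec (d := d)) where
  map_add z w := by ext k; simp [reVec]
  map_smul c z := by ext k; simp [reVec]

section

variable {I : Type*} [Countable I] {m : ℕ} {l : I → Fin m → ℝ} {q : I → ℕ → ℝ}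

/-- Near a common point of all regions inside the domain of convergence both sides equal (z_d - 1)
times the series. The overlap is convex, hence connected, and the identity theorem applies. -/
lemma IsGoodLevel.eqOn_continuation (h : IsGoodLevel l q) (n k : ℕ) :
    Set.EqOn (continuation (slope m n) l q) (continuation (slope m k) l q)
      (reVec ⁻¹' (region (slope m n) ∩ region (slope m k))) := by
  obtain ⟨x, hx, hxr⟩ := exists_common_mem m
  have hre : reVec (fun i => (x i : ℂ)) = x := by ext i; simp [reVec]
  have hmem : ∀ S : Set (Fin (m + 1) → ℝ), x ∈ S → (fun i => (x i : ℂ)) ∈ reVec ⁻¹' S :=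
    fun S hS => by rwa [Set.mem_preimage, hre]
  refine ((h.analyticOnNhd_continuation n).mono
    (Set.preimage_mono Set.inter_subset_left)).eqOn_of_preconnected_of_eventuallyEq
    ((h.analyticOnNhd_continuation k).mono (Set.preimage_mono Set.inter_subset_right))
    (((convex_region _).inter (convex_region _)).is_linear_preimage
      (isLinearMap_reVec _)).isPreconnected (hmem _ ⟨hxr n, hxr k⟩) ?_
  have hopen : IsOpen (reVec ⁻¹' (realDomain (m + 1) 1 ∩
      (region (slope m n) ∩ region (slope m k)))) :=
    ((isOpen_realDomain _ _).inter ((isOpen_region _).inter (isOpen_region _))).preimage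
      continuous_reVec
  filter_upwards [hopen.mem_nhds (hmem _ ⟨hx, hxr n, hxr k⟩)] with z hz
  rw [h.continuation_eq hz.1 hz.2.1, h.continuation_eq hz.1 hz.2.2]

/-- The function `(z_d - 1) ζ(z)` extends analytically to `Re z₁ > … > Re z_d > 1/2`. -/
theorem IsGoodLevel.exists_continuation (h : IsGoodLevel l q) :
    ∃ F : (Fin (m + 1) → ℂ) → ℂ, AnalyticOnNhd ℂ F (domain (m + 1) (1 / 2)) ∧
      ∀ z ∈ domain (m + 1) 1,
        F z = (z (Fin.last m) - 1) * ∑' p, cexpNeg z (extLog l q p) := by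
  classical
  have hex : ∀ z : Fin (m + 1) → ℂ, z ∈ domain (m + 1) (1 / 2) →
      ∃ n, reVec z ∈ region (slope m n) := fun z hz => exists_mem_region hz
  choose N hN using hex
  -- The choice of `N` need not be locally constant, but continuations for different indices agree
  -- wherever both apply.
  refine ⟨fun z => if hz : z ∈ domain (m + 1) (1 / 2) then
    continuation (slope m (N z hz)) l q z else 0, fun z hz => ?_, fun z hz => ?_⟩
  · refine (h.analyticOnNhd_continuation (N z hz) z (hN z hz)).congr ?_
    filter_upwards [(isOpen_domain _ _).mem_nhds hz,
      ((isOpen_region (slope m (N z hz))).preimage continuous_reVec).mem_nhds (hN z hz)]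
      with w hw hw2
    rw [dif_pos hw]
    exact h.eqOn_continuation _ _ ⟨hw2, hN w hw⟩
  · have hz2 : z ∈ domain (m + 1) (1 / 2) := ⟨hz.1, fun i => by linarith [hz.2 i]⟩
    beta_reduce
    rw [dif_pos hz2]
    exact h.continuation_eq hz (hN z hz2)

end

/-! ### Almost every realisation is good -/

section

variable {Ω I : Type*} [MeasurableSpace Ω] [Countable I] {μ : Measure Ω} [IsProbabilityMeasure μ]
  {m : ℕ}

/-- Almost every realisation of independent Poisson processes attached to an independent random
array is good. -/
theorem ae_isGoodLevel {L : Ω → I → Fin m → ℝ} (hL : Measurable L) {Q : I → ℕ → Ω → ℝ}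
    (hQ : ∀ i, IsUnitPoissonPoints (Q i) μ) (hind : iIndepFun (fun i ω j => Q i j ω) μ)
    (hLQ : IndepFun L (fun ω i j => Q i j ω) μ) (hbase : ∀ᵐ ω ∂μ, FiniteExpSums (L ω)) :
    ∀ᵐ ω ∂μ, IsGoodLevel (L ω) (fun i j => Q i j ω) := by
  have hmQ : Measurable fun ω i j => Q i j ω :=
    measurable_pi_lambda _ fun i => measurable_pi_lambda _ fun j => (hQ i).measurable j
  have hpos : ∀ᵐ ω ∂μ, ∀ i j, 0 < Q i j ω := ae_all_iff.2 fun i => (hQ i).ae_pos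
  have hlow : ∀ᵐ ω ∂μ, ∀ n, lowCount (slope m n) (L ω) (fun i j => Q i j ω) ≠ ∞ := by
    refine ae_all_iff.2 fun n => ?_
    refine ae_ne_top_of_indepFun hL hmQ hLQ (measurable_lowCount _) ?_
    filter_upwards [hbase] with ω hω
    exact lintegral_lowCount_ne_top hQ (slope_mem m n) hω
  have hhigh : ∀ᵐ ω ∂μ, ∀ n (x : Fin (m + 1) → ℚ), 1 < ratVec x (Fin.last m) →
      affExp 1 (slope m n) (ratVec x) ∈ realDomain m 1 →
      highSum (slope m n) (ratVec x) (L ω) (fun i j => Q i j ω) ≠ ∞ := by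
    refine ae_all_iff.2 fun n => ae_all_iff.2 fun x => ?_
    by_cases hx : 1 < ratVec x (Fin.last m) ∧ affExp 1 (slope m n) (ratVec x) ∈ realDomain m 1
    · have := ae_ne_top_of_indepFun hL hmQ hLQ (measurable_highSum (slope m n) (ratVec x)) (by
        filter_upwards [hbase] with ω hω
        exact lintegral_highSum_ne_top hQ hx.1 hx.2 hω)
      filter_upwards [this] with ω hω _ _ using hω
    · exact ae_of_all _ fun ω h1 h2 => absurd ⟨h1, h2⟩ hx
  have habs : ∀ᵐ ω ∂μ, ∀ n (x : Fin (m + 1) → ℚ), ratVec x ∈ region (slope m n) →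
      absIntegral (slope m n) (ratVec x) (L ω) (fun i j => Q i j ω) ≠ ∞ := by
    refine ae_all_iff.2 fun n => ae_all_iff.2 fun x => ?_
    by_cases hx : ratVec x ∈ region (slope m n)
    · have := ae_ne_top_of_indepFun hL hmQ hLQ (measurable_absIntegral (slope m n) (ratVec x)) (by
        filter_upwards [hbase] with ω hω
        exact lintegral_absIntegral_ne_top hQ hind hx.1 hx.2.2 hω)
      filter_upwards [this] with ω hω _ using hω
    · exact ae_of_all _ fun ω h1 => absurd h1 hx
  filter_upwards [hbase, hpos, hlow, hhigh, habs] with ω h1 h2 h3 h4 h5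
  exact ⟨h1, h2, h3, h4, h5⟩

end

lemma comap_pi_le_iSup_range {Ω ι C β : Type*} [MeasurableSpace β] (f : ι → Ω → β) (w : C → ι) :
    MeasurableSpace.comap (fun ω c => f (w c) ω) MeasurableSpace.pi ≤
      ⨆ i ∈ Set.range w, MeasurableSpace.comap (f i) inferInstance := by
  rw [← measurable_iff_comap_le]
  refine @measurable_pi_lambda _ _ _ (_) _ _ fun c => ?_
  rw [measurable_iff_comap_le]
  exact le_iSup₂_of_le (w c) ⟨c, rfl⟩ le_rfl

/-- Disjoint subfamilies of an independent family are independent. -/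
lemma iIndepFun.indepFun_comp_of_disjoint_range {Ω ι A B β : Type*} [MeasurableSpace Ω]
    [MeasurableSpace β] {μ : Measure Ω} {f : ι → Ω → β} (hf : iIndepFun f μ)
    (hm : ∀ i, Measurable (f i)) {u : A → ι} {v : B → ι} (huv : ∀ a b, u a ≠ v b) :
    IndepFun (fun ω a => f (u a) ω) (fun ω b => f (v b) ω) μ := by
  have hdisj : Disjoint (Set.range u) (Set.range v) := by
    rw [Set.disjoint_left]
    rintro _ ⟨a, rfl⟩ ⟨b, hb⟩
    exact huv a b hb.symm
  have h := indep_iSup_of_disjoint (fun i => (hm i).comap_le) hf.iIndep hdisj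
  rw [IndepFun_iff_Indep]
  exact indep_of_indep_of_le_left (indep_of_indep_of_le_right h (comap_pi_le_iSup_range f v))
    (comap_pi_le_iSup_range f u)

/-! ### Splitting off the last level of the cascade, and the induction -/

section Cascade

/-- The logarithms of the coordinates of the points of the cascade. -/
def cascadeLog {d : ℕ} (p : Prefix d → ℕ → ℝ) (ε : Fin d → ℕ) (k : Fin d) : ℝ :=
  Real.log (p ⟨k, fun j : Fin k => ε (Fin.castLE k.isLt.le j)⟩ (ε k))

/-- The vertices of the first `m` levels, as vertices of a cascade with `m + 1` levels. -/
def prefixCastSucc {m : ℕ} (v : Prefix m) : Prefix (m + 1) := ⟨v.1.castSucc, v.2⟩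

/-- The vertices of the last level. -/
def prefixLast {m : ℕ} (ε : Fin m → ℕ) : Prefix (m + 1) := ⟨Fin.last m, ε⟩

lemma prefixCastSucc_injective {m : ℕ} : Function.Injective (prefixCastSucc (m := m)) := by
  rintro ⟨i, v⟩ ⟨j, w⟩ h
  obtain rfl : i = j := Fin.castSucc_injective m (congrArg Sigma.fst h)
  simpa [prefixCastSucc] using h

lemma prefixLast_injective {m : ℕ} : Function.Injective (prefixLast (m := m)) := by
  intro v w h
  simpa [prefixLast] using h

lemma prefixCastSucc_ne_prefixLast {m : ℕ} (v : Prefix m) (ε : Fin m → ℕ) :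
    prefixCastSucc v ≠ prefixLast ε := fun h =>
  (Fin.castSucc_lt_last v.1).ne (congrArg Sigma.fst h)

/-- Appending an index. -/
def snocEquiv (m : ℕ) : (Fin m → ℕ) × ℕ ≃ (Fin (m + 1) → ℕ) :=
  (Equiv.prodComm _ _).trans (Fin.snocEquiv fun _ => ℕ)

lemma snocEquiv_apply {m : ℕ} (p : (Fin m → ℕ) × ℕ) :
    snocEquiv m p = Fin.snoc (α := fun _ => ℕ) p.1 p.2 := rfl

lemma cascadeLog_snocEquiv {m : ℕ} (p : Prefix (m + 1) → ℕ → ℝ) (r : (Fin m → ℕ) × ℕ) :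
    cascadeLog p (snocEquiv m r) =
      extLog (cascadeLog fun v => p (prefixCastSucc v)) (fun ε => p (prefixLast ε)) r := by
  ext k
  have hsnoc : ∀ i : Fin m, snocEquiv m r i.castSucc = r.1 i := fun i => by
    rw [snocEquiv_apply, Fin.snoc_castSucc]
  have hlast : snocEquiv m r (Fin.last m) = r.2 := by
    rw [snocEquiv_apply, Fin.snoc_last]
  induction k using Fin.lastCases with
  | last =>
    rw [extLog, Fin.snoc_last, cascadeLog, hlast]
    congr 2
    exact congrArg prefixLast (funext fun i => hsnoc i)
  | cast k =>
    rw [extLog, Fin.snoc_castSucc, cascadeLog, cascadeLog, hsnoc]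
    have : (fun j : Fin k => snocEquiv m r (Fin.castLE k.castSucc.isLt.le j)) =
        fun j : Fin k => r.1 (Fin.castLE k.isLt.le j) :=
      funext fun j => hsnoc (Fin.castLE k.isLt.le j)
    exact congrArg (fun w => Real.log (p (prefixCastSucc ⟨k, w⟩) (r.1 k))) this

lemma FiniteExpSums.of_comp_equiv {I J : Type*} {d : ℕ} {l : J → Fin d → ℝ} (e : I ≃ J)
    (h : FiniteExpSums fun i => l (e i)) : FiniteExpSums l := by
  intro x hx
  rw [← e.tsum_eq]
  exact h x hx

lemma zetaTerm_eq {Ω : Type*} {d : ℕ} {P : Prefix d → ℕ → Ω → ℝ} {ω : Ω} (hpos : ∀ v j, 0 < P v j ω)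
    (ε : Fin d → ℕ) (z : Fin d → ℂ) :
    zetaTerm P ω ε z = cexpNeg z (cascadeLog (fun v j => P v j ω) ε) := by
  rw [cexpNeg_eq_prod, zetaTerm]
  refine Finset.prod_congr rfl fun k _ => ?_
  have h : 0 < coord P ε k ω := hpos _ _
  rw [Complex.cpow_def_of_ne_zero (by exact_mod_cast h.ne'), ← Complex.ofReal_log h.le, mul_neg,
    mul_comm]
  rfl

variable {Ω : Type*} [MeasurableSpace Ω] {μ : Measure Ω}

lemma IsPoissonCascade.castSucc {m : ℕ} {P : Prefix (m + 1) → ℕ → Ω → ℝ}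
    (hP : IsPoissonCascade (m + 1) P μ) :
    IsPoissonCascade m (fun v => P (prefixCastSucc v)) μ where
  points _ := hP.points _
  indep := hP.indep.precomp prefixCastSucc_injective

lemma measurable_cascadeLog {d : ℕ} : Measurable (cascadeLog (d := d)) := by
  refine measurable_pi_lambda _ fun ε => measurable_pi_lambda _ fun k => ?_
  exact Real.measurable_log.comp ((measurable_pi_apply _).comp (measurable_pi_apply _))

lemma IsPoissonCascade.measurable {d : ℕ} {P : Prefix d → ℕ → Ω → ℝ}
    (hP : IsPoissonCascade d P μ) : Measurable fun ω v j => P v j ω :=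
  measurable_pi_lambda _ fun v => measurable_pi_lambda _ fun j => (hP.points v).measurable j

/-- The last-level processes and the earlier levels sit at disjoint sets of vertices, hence are
independent. -/
lemma IsPoissonCascade.ae_isGoodLevel [IsProbabilityMeasure μ] {m : ℕ}
    {P : Prefix (m + 1) → ℕ → Ω → ℝ} (hP : IsPoissonCascade (m + 1) P μ)
    (hbase : ∀ᵐ ω ∂μ, FiniteExpSums (cascadeLog fun v j => P (prefixCastSucc v) j ω)) :
    ∀ᵐ ω ∂μ, IsGoodLevel (cascadeLog fun v j => P (prefixCastSucc v) j ω)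
      (fun ε j => P (prefixLast ε) j ω) := by
  have hm : ∀ v, Measurable fun ω j => P v j ω := fun v =>
    measurable_pi_lambda _ fun j => (hP.points v).measurable j
  refine PoissonCascade.ae_isGoodLevel (Q := fun ε => P (prefixLast ε))
    (measurable_cascadeLog.comp hP.castSucc.measurable) (fun ε => hP.points _)
    (hP.indep.precomp prefixLast_injective) ?_ hbase
  exact (iIndepFun.indepFun_comp_of_disjoint_range hP.indep hm
    prefixCastSucc_ne_prefixLast).comp measurable_cascadeLog measurable_id

theorem IsPoissonCascade.ae_finiteExpSums [IsProbabilityMeasure μ] :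
    ∀ {d : ℕ} {P : Prefix d → ℕ → Ω → ℝ}, IsPoissonCascade d P μ →
      ∀ᵐ ω ∂μ, FiniteExpSums (cascadeLog fun v j => P v j ω) := by
  intro d
  -- The base case is a sum over the single empty label; the inductive step is the convergence of
  -- the series for one more level on good realisations.
  induction d with
  | zero =>
    intro P _
    refine ae_of_all _ fun ω x _ => ?_
    rw [tsum_fintype]
    exact ENNReal.sum_ne_top.2 fun _ _ => ENNReal.ofReal_ne_top
  | succ m ih =>
    intro P hP
    filter_upwards [hP.ae_isGoodLevel (ih hP.castSucc)] with ω hω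
    refine FiniteExpSums.of_comp_equiv (snocEquiv m) ?_
    simp_rw [cascadeLog_snocEquiv]
    exact hω.finiteExpSums_extLog

lemma isMeromorphicOn_div_coord_sub_one {d : ℕ} (k : Fin d) {F : (Fin d → ℂ) → ℂ}
    {U : Set (Fin d → ℂ)} (hF : AnalyticOnNhd ℂ F U) :
    IsMeromorphicOn (fun z => F z / (z k - 1)) U := by
  intro x hx
  refine ⟨F, fun z => z k - 1, hF x hx, (analyticAt_coord k x).sub analyticAt_const, fun h => ?_,
    Eventually.of_forall fun _ _ => rfl⟩
  -- If z_k - 1 vanished near `x`, it would vanish at two consecutive points of this sequence,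
  -- forcing 1/(n+1) = 1/(n+2).
  have hc : Tendsto (fun n : ℕ => fun i : Fin d => x i + (1 / ((n : ℂ) + 1))) atTop (𝓝 x) := by
    refine tendsto_pi_nhds.2 fun i => ?_
    simpa using (tendsto_one_div_add_atTop_nhds_zero_nat (𝕜 := ℂ)).const_add (x i)
  obtain ⟨n, hn1, hn2⟩ := ((hc.eventually h).and
    (hc.comp (tendsto_add_atTop_nat 1) |>.eventually h)).exists
  simp only [Function.comp_apply] at hn2
  have h1 : (1 : ℂ) / ((n : ℂ) + 1) = 1 / (((n + 1 : ℕ) : ℂ) + 1) := by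
    linear_combination hn1 - hn2
  have h2 : (n : ℂ) + 1 ≠ 0 := by exact_mod_cast Nat.succ_ne_zero n
  have h3 : ((n + 1 : ℕ) : ℂ) + 1 ≠ 0 := by exact_mod_cast Nat.succ_ne_zero (n + 1)
  rw [div_eq_div_iff h2 h3] at h1
  push_cast at h1
  simp at h1

end Cascade

end

end PoissonCascade

theorem theorem2p11 {Ω : Type*} [MeasurableSpace Ω] (μ : Measure Ω) [IsProbabilityMeasure μ]
    (d : ℕ) (hd : 0 < d) (P : PoissonCascade.Prefix d → ℕ → Ω → ℝ)
    (hP : PoissonCascade.IsPoissonCascade d P μ) :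
    ∀ᵐ ω ∂μ,
      -- absolute convergence on the domain `Re z₁ > … > Re z_d > 1`
      (∀ z ∈ PoissonCascade.domain d 1,
        Summable (fun ε : Fin d → ℕ => ‖PoissonCascade.zetaTerm P ω ε z‖)) ∧
      -- uniform convergence on compact subsets, of the series of absolute values and of the series
      (∀ K : Set (Fin d → ℂ), IsCompact K → K ⊆ PoissonCascade.domain d 1 →
        TendstoUniformlyOn
          (fun (s : Finset (Fin d → ℕ)) (z : Fin d → ℂ) =>
            ∑ ε ∈ s, ‖PoissonCascade.zetaTerm P ω ε z‖)
          (fun z => ∑' ε : Fin d → ℕ, ‖PoissonCascade.zetaTerm P ω ε z‖) atTop K ∧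
        TendstoUniformlyOn
          (fun (s : Finset (Fin d → ℕ)) (z : Fin d → ℂ) =>
            ∑ ε ∈ s, PoissonCascade.zetaTerm P ω ε z)
          (PoissonCascade.zeta P ω) atTop K) ∧
      AnalyticOnNhd ℂ (PoissonCascade.zeta P ω) (PoissonCascade.domain d 1) ∧
      -- meromorphic continuation `f` to `Re z₁ > … > Re z_d > 1/2`
      ∃ f : (Fin d → ℂ) → ℂ,
        PoissonCascade.IsMeromorphicOn f (PoissonCascade.domain d (1 / 2)) ∧
        Set.EqOn f (PoissonCascade.zeta P ω) (PoissonCascade.domain d 1) ∧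
        -- `(z_d - 1) f(z)` is analytic there, its values at `z_d = 1` being given by continuity
        ∃ F : (Fin d → ℂ) → ℂ,
          AnalyticOnNhd ℂ F (PoissonCascade.domain d (1 / 2)) ∧
          ∀ z ∈ PoissonCascade.domain d (1 / 2), z ⟨d - 1, Nat.sub_lt hd Nat.one_pos⟩ ≠ 1 →
            F z = (z ⟨d - 1, Nat.sub_lt hd Nat.one_pos⟩ - 1) * f z := by
  -- Since d ≥ 1 there is a last level to split off; the index `d - 1` of the statement becomes
  -- `Fin.last m`.
  obtain ⟨m, rfl⟩ : ∃ m, d = m + 1 := ⟨d - 1, by omega⟩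
  have hpos : ∀ᵐ ω ∂μ, ∀ v j, 0 < P v j ω := ae_all_iff.2 fun v => (hP.points v).ae_pos
  filter_upwards [hpos, hP.ae_finiteExpSums, hP.ae_isGoodLevel hP.castSucc.ae_finiteExpSums]
    with ω hω hfin hgood
  have hterm : ∀ ε z, PoissonCascade.zetaTerm P ω ε z =
      PoissonCascade.cexpNeg z (PoissonCascade.cascadeLog (fun v j => P v j ω) ε) :=
    PoissonCascade.zetaTerm_eq hω
  have hzeta : PoissonCascade.zeta P ω = fun z => ∑' ε, PoissonCascade.cexpNeg z
      (PoissonCascade.cascadeLog (fun v j => P v j ω) ε) := by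
    ext z
    exact tsum_congr fun ε => hterm ε z
  refine ⟨fun z hz => ?_, fun K hK hKD => ⟨?_, ?_⟩, ?_, ?_⟩
  · simp_rw [hterm]
    exact hfin.summable_norm hz
  · exact hfin.tendstoUniformlyOn hK hKD
      (f := fun ε z => ‖PoissonCascade.zetaTerm P ω ε z‖) fun ε z => by rw [norm_norm, hterm]
  · exact hfin.tendstoUniformlyOn hK hKD
      (f := fun ε z => PoissonCascade.zetaTerm P ω ε z) fun ε z => by rw [hterm]
  · rw [hzeta]
    exact hfin.analyticOnNhd
  · obtain ⟨F, hF, hFeq⟩ := hgood.exists_continuation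
    -- On the hyperplane z_d = 1 this quotient takes the default value 0, which is harmless: both
    -- meromorphy and the relation with `F` disregard those points.
    refine ⟨fun z => F z / (z (Fin.last m) - 1),
      PoissonCascade.isMeromorphicOn_div_coord_sub_one _ hF, fun z hz => ?_, F, hF,
      fun z _ hz1 => (mul_div_cancel₀ _ (sub_ne_zero.2 hz1)).symm⟩
    have hre : 1 < (z (Fin.last m)).re := hz.2 _
    have hne : z (Fin.last m) - 1 ≠ 0 := fun h0 => by
      rw [sub_eq_zero] at h0
      simp [h0] at hre
    rw [hzeta]
    simp only
    rw [hFeq z hz, mul_div_cancel_left₀ _ hne, ← (PoissonCascade.snocEquiv m).tsum_eq]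
    simp_rw [PoissonCascade.cascadeLog_snocEquiv]
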